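/- Let $\Phi=(M,\mathfrak R,M^\vee,\mathfrak R^\vee)$ be a reduced root datum (with $M$, $M^\vee$ free of finite rank and $\mathfrak R$ finite), with Weyl group $W_\Phi$, let $\Delta\subset\mathfrak R$ be a basis with set of positive roots $\mathfrak R_+$, and let a group $A$ (possibly infinite) act on $\Phi$ by automorphisms preserving $\Delta$. Let $M_A$ be the coinvariants of $M$, let $(M^\vee)^A$ be the invariants of $M^\vee$, paired with $M_A/\mathrm{tor}$ through the pairing of $M^\vee$ with $M$, and let $(W_\Phi)^A$ be the subgroup of $W_\Phi$ fixed by the conjugation action of $A$. For $\alpha,\beta\in\mathfrak R_+$ write $\alpha\sim\beta$ if $\sum_{\gamma\in A\alpha}\gamma$ and $\sum_{\delta\in A\beta}\delta$ are scalar multiples of one another in $\mathbb R\otimes_{\mathbb Z}M$. An equivalence class $E$ is of type (i$'$) if it is a single $A$-orbit and $\alpha+\beta\notin\mathfrak R$ for all $\alpha,\beta\in E$; it is of type (ii$'$) if it is the union of the $A$-translates of a set of roots $\{\alpha,a\alpha,\alpha+a\alpha\}$ with $a\in A$. A positive root is special if its class $E$ is of type (ii$'$) and it is a sum of two elements of $E$.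 Let $\mathfrak R^{(A)}$ and $\Delta^{(A)}$ be the images of $\mathfrak R$ and $\Delta$ in $M_A/\mathrm{tor}$. Let $\mathfrak R^{(A)}_{\mathrm{nd,nm}}$, $\mathfrak R^{(A)}_{\mathrm m}$ and $\mathfrak R^{(A)}_{\mathrm d}$ be the sets of all $\pm\bar\alpha$, where $\bar\alpha$ is the image of a positive root $\alpha$ which, respectively, lies in a class of type (i$'$), is nonspecial in a class of type (ii$'$), or is special. Put $$\mathfrak R_1^{(A)}=\mathfrak R^{(A)}_{\mathrm{nd,nm}}\cup\mathfrak R^{(A)}_{\mathrm m},\qquad \mathfrak R_2^{(A)}=\mathfrak R^{(A)}_{\mathrm{nd,nm}}\cup\mathfrak R^{(A)}_{\mathrm d},$$ $$\Delta_2^{(A)}=(\Delta^{(A)}\cap\mathfrak R^{(A)}_{\mathrm{nd,nm}})\cup\{2\gamma:\gamma\in\Delta^{(A)}\cap\mathfrak R^{(A)}_{\mathrm m}\}.$$ For $\gamma=\bar\alpha$ with $\alpha\in\mathfrak R_+$ in the class $E$, put $\gamma^\vee=\sum_{\beta\in E}\beta^\vee$ if $\alpha$ is not special and $\gamma^\vee=\sum_{\beta\in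 E,\ \beta\text{ special}}\beta^\vee$ if $\alpha$ is special; put $(-\gamma)^\vee=-\gamma^\vee$. Let $\mathfrak R^{(A),\vee}$, $\mathfrak R_1^{(A),\vee}$ and $\mathfrak R_2^{(A),\vee}$ be the corresponding sets of coroots. Then two roots with the same image in $M_A/\mathrm{tor}$ lie in the same $A$-orbit, $\mathfrak R^{(A)}=\mathfrak R_1^{(A)}\cup\mathfrak R_2^{(A)}$, the elements $\gamma^\vee$ are well defined and lie in $(M^\vee)^A$, and: 1. $(M_A/\mathrm{tor},\mathfrak R_1^{(A)},(M^\vee)^A,\mathfrak R_1^{(A),\vee})$ is a reduced root datum with basis $\Delta^{(A)}$; 2. $(M_A/\mathrm{tor},\mathfrak R_2^{(A)},(M^\vee)^A,\mathfrak R_2^{(A),\vee})$ is a reduced root datum with basis $\Delta_2^{(A)}$; 3. $(M_A/\mathrm{tor},\mathfrak R^{(A)},(M^\vee)^A,\mathfrak R^{(A),\vee})$ is a (not necessarily reduced) root datum with basis $\Delta^{(A)}$. In all three cases the Weyl group is $(W_\Phi)^A$: the natural action of $(W_\Phi)^A$ on $M_A/\mathrm{tor}$ is faithful, and its image is the Weyl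 group of the root datum. -/

import Mathlib

open scoped TensorProduct

noncomputable section

namespace FoldedRootDatum

section Basis

variable {κ X Y : Type*} [AddCommGroup X] [AddCommGroup Y]

/-- `D ⊆ X` is a basis (system of simple roots) of the root datum `Q`, which need not be reduced:
it is a linearly independent set of roots, and every root is a combination of elements of `D`
whose coefficients are integers that are all nonnegative or all nonpositive.
(For reduced root data one has `RootPairing.Base`; that notion also constrains the coroots in a way
that excludes non-reduced root data.) -/
structure IsBasis (Q : RootDatum κ X Y) (D : Set X) : Prop where
  subset_range : D ⊆ Set.range Q.root
  linearIndep : LinearIndepOn ℤ id D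
  mem_or_neg_mem : ∀ k, Q.root k ∈ AddSubmonoid.closure D ∨ -Q.root k ∈ AddSubmonoid.closure D

end Basis

variable {ι M N A : Type*} [AddCommGroup M] [AddCommGroup N] [Group A]
variable {P : RootDatum ι M N}

/-- The action of `A` on `M`. -/
def weightRep (ρ : A →* P.Aut) : Representation ℤ A M where
  toFun a := (ρ a).weightMap
  map_one' := by rw [map_one]; rfl
  map_mul' a a' := by rw [map_mul]; rfl

/-- The (contragredient) action of `A` on `M^∨ = N`. The map on coweights that is part of an
automorphism of a root pairing is contravariant, hence the inverse. -/
def coweightRep (ρ : A →* P.Aut) : Representation ℤ A N where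
  toFun a := (ρ a⁻¹).coweightMap
  map_one' := by rw [inv_one, map_one]; rfl
  map_mul' a a' := by rw [mul_inv_rev, map_mul]; rfl

/-- The lattice `M_A / tor`. -/
abbrev CoinvLattice (ρ : A →* P.Aut) : Type _ :=
  (weightRep ρ).Coinvariants ⧸ Submodule.torsion ℤ (weightRep ρ).Coinvariants

/-- The lattice `(M^∨)^A`. -/
abbrev InvLattice (ρ : A →* P.Aut) : Type _ := (coweightRep ρ).invariants

/-- The projection `M → M_A → M_A / tor`. -/
def proj (ρ : A →* P.Aut) : M →ₗ[ℤ] CoinvLattice ρ :=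
  (Submodule.mkQ _).comp (Representation.Coinvariants.mk (weightRep ρ))

/-- The `A`-orbit of a root. -/
def orbit (ρ : A →* P.Aut) (i : ι) : Set ι := {j | ∃ a, ρ a • i = j}

section Classes

variable [Fintype ι]

open scoped Classical in
/-- The sum of the `A`-orbit of a root, in `M`. -/
def orbitSum (ρ : A →* P.Aut) (i : ι) : M := ∑ j with j ∈ orbit ρ i, P.root j

/-- `i ∼ j`: the sums of the two `A`-orbits are scalar multiples of one another in `ℝ ⊗ M`. -/
def Rel (ρ : A →* P.Aut) (i j : ι) : Prop :=
  ∃ c : ℝ, c ≠ 0 ∧ (1 : ℝ) ⊗ₜ[ℤ] orbitSum ρ j = c • ((1 : ℝ) ⊗ₜ[ℤ] orbitSum ρ i)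

variable (b : P.Base) (ρ : A →* P.Aut)

/-- The equivalence class of `i` for `∼` in the set of positive roots. -/
def eqvClass (i : ι) : Set ι := {j | b.IsPos j ∧ Rel ρ i j}

/-- `E` is of the first type: it is a single `A`-orbit, and no sum of two elements of `E`
is a root. -/
def IsTypeI (E : Set ι) : Prop :=
  (∃ i, E = orbit ρ i) ∧ ∀ i ∈ E, ∀ j ∈ E, P.root i + P.root j ∉ Set.range P.root

/-- `E` is of the second type: it is the union of the `A`-translates of a set of roots of the form
`{α, a α, α + a α}`. -/
def IsTypeII (E : Set ι) : Prop :=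
  ∃ (i k : ι) (a : A), P.root k = P.root i + P.root (ρ a • i) ∧
    E = {j | ∃ c : A, ∃ l ∈ ({i, ρ a • i, k} : Set ι), ρ c • l = j}

/-- A positive root is special if its equivalence class is of the second type and it is the sum of
two elements of that class. -/
def IsSpecial (i : ι) : Prop :=
  b.IsPos i ∧ IsTypeII ρ (eqvClass b ρ i) ∧
    ∃ j ∈ eqvClass b ρ i, ∃ k ∈ eqvClass b ρ i, P.root i = P.root j + P.root k

/-- The image in `M_A / tor` of the set of roots with indices in `s`. -/
def imageRoots (s : Set ι) : Set (CoinvLattice ρ) := (fun i ↦ proj ρ (P.root i)) '' s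

/-- The union of `s` and `-s`. -/
def symmetrize {L : Type*} [AddCommGroup L] (s : Set L) : Set L := {x | x ∈ s ∨ -x ∈ s}

/-- The set `R^(A)`. -/
def RA : Set (CoinvLattice ρ) := imageRoots ρ Set.univ

/-- The set of roots of `R^(A)` that are neither divisible nor multipliable. -/
def RAndnm : Set (CoinvLattice ρ) :=
  symmetrize (imageRoots ρ {i | b.IsPos i ∧ IsTypeI ρ (eqvClass b ρ i)})

/-- The set of multipliable roots of `R^(A)`. -/
def RAm : Set (CoinvLattice ρ) :=
  symmetrize (imageRoots ρ {i | b.IsPos i ∧ IsTypeII ρ (eqvClass b ρ i) ∧ ¬ IsSpecial b ρ i})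

/-- The set of divisible roots of `R^(A)`. -/
def RAd : Set (CoinvLattice ρ) := symmetrize (imageRoots ρ {i | IsSpecial b ρ i})

/-- The set `R_1^(A)`. -/
def RA₁ : Set (CoinvLattice ρ) := RAndnm b ρ ∪ RAm b ρ

/-- The set `R_2^(A)`. -/
def RA₂ : Set (CoinvLattice ρ) := RAndnm b ρ ∪ RAd b ρ

/-- The set `Δ^(A)`. -/
def ΔA : Set (CoinvLattice ρ) := imageRoots ρ b.support

/-- The set `Δ_2^(A)`. -/
def ΔA₂ : Set (CoinvLattice ρ) :=
  (ΔA b ρ ∩ RAndnm b ρ) ∪ {x | ∃ y ∈ ΔA b ρ ∩ RAm b ρ, x = (2 : ℤ) • y}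

open scoped Classical in
/-- For a positive root `i` with equivalence class `E`: the sum of the coroots of the special
elements of `E` if `i` is special, and the sum of the coroots of all elements of `E` if not. -/
def posCoroot (i : ι) : N :=
  if IsSpecial b ρ i then ∑ j with j ∈ eqvClass b ρ i ∧ IsSpecial b ρ j, P.coroot j
  else ∑ j with j ∈ eqvClass b ρ i, P.coroot j

open scoped Classical in
/-- The coroot attached to the image of the root `i` in `M_A / tor`, extended to negative roots by
`γ^∨ = -(-γ)^∨`. Here `P.reflectionPerm i i` is the index of the negative of the root `i`. -/
def foldedCoroot (i : ι) : N :=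
  if b.IsPos i then posCoroot b ρ i else -posCoroot b ρ (P.reflectionPerm i i)

/-- `Q` is the quadruple `(M_A / tor, S, (M^∨)^A, S^∨)`, for a set `S ⊆ R^(A)`: the pairing is
induced by that of `M` and `M^∨`, the set of roots is `S`, and the coroots are given by the
formula of `foldedCoroot`. -/
structure IsFolded (S : Set (CoinvLattice ρ)) (Q : RootDatum S (CoinvLattice ρ) (InvLattice ρ)) :
    Prop where
  finite : S.Finite
  subset : S ⊆ RA ρ
  pairing : ∀ (m : M) (n : InvLattice ρ), Q.toLinearMap (proj ρ m) n = P.toLinearMap m (n : N)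
  root : ∀ s : S, Q.root s = s
  coroot : ∀ (i : ι) (h : proj ρ (P.root i) ∈ S),
    ((Q.coroot ⟨proj ρ (P.root i), h⟩ : InvLattice ρ) : N) = foldedCoroot b ρ i

end Classes

/-- The group `(W_Φ)^A` of elements of the Weyl group that are fixed by `A`, which acts by
conjugation inside the automorphism group of the root datum. -/
def fixedWeyl (ρ : A →* P.Aut) : Subgroup P.Aut :=
  P.weylGroup ⊓ Subgroup.centralizer (Set.range ρ)

/-- The Weyl group of `Q` is `(W_Φ)^A`, through the action of the latter on `M_A / tor` that is
induced by its action on `M`. -/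
def HasWeylGroup (ρ : A →* P.Aut) {S : Set (CoinvLattice ρ)}
    (Q : RootDatum S (CoinvLattice ρ) (InvLattice ρ)) : Prop :=
  ∃ e : fixedWeyl ρ ≃* Q.weylGroup, ∀ (w : fixedWeyl ρ) (m : M),
    (e w : Q.Aut) • proj ρ m = proj ρ ((w : P.Aut) • m)

end FoldedRootDatum

end

/-! Everything is read off from single A-orbits of roots. As A permutes the simple roots, it
preserves heights, and the sum of the positive coroots is an invariant vector that pairs with each
root to twice its height; so the height depends only on the image in M_A/tor. The difference of two
distinct conjugate roots would be a root of height 0, hence is not a root, and conjugate roots pair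
nonpositively. On the other hand the orbit sum has positive norm for `RootForm`, so the pairing of α
with the sum of the coroots in its orbit, which is 2 plus nonpositive integers, is positive. Hence
an orbit is either orthogonal (`pairing_of_not_mult`) or splits into pairs spanning A₂
(`pairing_of_mult`).

The same positivity shows that roots with equal images are conjugate (`mem_orbit_of_proj_eq`) and
that proportional images of positive roots have ratio 1, 2 or 1/2 (`height_of_ray`). So a class for
∼ is one orthogonal orbit, or an orbit of A₂-pairs together with the orbit of their sums. This
translates the types into `Mult` and `Div`, and identifies γ^∨ with once or twice an orbit sum of
coroots (`posCoroot_eq`).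

The product of the reflections in an orthogonal orbit lies in (W_Φ)^A and induces the reflection in
γ. For a multipliable γ one takes 2γ instead, which gives the same reflection because α and α + aα
have the same orbit sum of coroots (`orbC_of_root_eq_add`). Thus the images of any (W_Φ)^A-stable
set of roots form a root datum (`foldedDatum`). Bases come from independence of orbit sums of simple
roots and from passing sign conditions between roots and coroots (`coroot_mem_or_neg_mem`). An
element of (W_Φ)^A that is trivial on M_A/tor preserves heights, so it is 1; and the orbit
reflections generate (W_Φ)^A by a length argument (`mem_closure_orbitReflections`). -/

noncomputable section

namespace FoldedRootDatum

/-! ### Automorphisms of a root datum -/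

section RootDatum

variable {ι M N : Type*} [AddCommGroup M] [AddCommGroup N] {P : RootDatum ι M N}

lemma pairingIn_int (i j : ι) : P.pairingIn ℤ i j = P.pairing i j := by
  simpa using P.algebraMap_pairingIn ℤ i j

lemma root_smul (g : P.Aut) (i : ι) : P.root (g • i) = g • P.root i :=
  RootPairing.Equiv.root_indexEquiv_eq_smul P i g

lemma toLinearMap_smul (g : P.Aut) (m : M) (n : N) :
    P.toLinearMap (g • m) n = P.toLinearMap m (g.coweightMap n) := by
  have := LinearMap.congr_fun (RootPairing.Hom.weight_coweight_transpose_apply P P n g.toHom) m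
  exact this

lemma coweightMap_coroot_smul (g : P.Aut) (i : ι) :
    g.coweightMap (P.coroot (g • i)) = P.coroot i := by
  have := RootPairing.Hom.coroot_coweightMap_apply P P (g • i) g.toHom
  rw [this]
  exact congrArg _ (g.indexEquiv.symm_apply_apply i)

lemma pairing_smul_smul (g : P.Aut) (i j : ι) : P.pairing (g • i) (g • j) = P.pairing i j := by
  simp only [← P.root_coroot_eq_pairing, root_smul, toLinearMap_smul, coweightMap_coroot_smul]

lemma aut_ext {g h : P.Aut} (H : ∀ m : M, g • m = h • m) : g = h :=
  RootPairing.Equiv.weightHom_injective P (LinearEquiv.ext H)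

lemma eq_of_toLinearMap_left {x y : M} (h : ∀ n, P.toLinearMap x n = P.toLinearMap y n) : x = y :=
  P.toPerfPair.injective (LinearMap.ext h)

lemma eq_of_toLinearMap_right {x y : N} (h : ∀ m, P.toLinearMap m x = P.toLinearMap m y) : x = y :=
  P.flip.toPerfPair.injective (LinearMap.ext h)

lemma smul_reflection_mul (g : P.Aut) (i : ι) :
    g * RootPairing.Equiv.reflection P i = RootPairing.Equiv.reflection P (g • i) * g := by
  refine aut_ext fun m ↦ ?_
  rw [mul_smul, mul_smul, RootPairing.Equiv.reflection_smul, RootPairing.Equiv.reflection_smul,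
    P.reflection_apply, P.reflection_apply, smul_sub, smul_comm, root_smul]
  congr 2
  simp [toLinearMap_smul, coweightMap_coroot_smul]

lemma reflection_mul_self (i : ι) :
    RootPairing.Equiv.reflection P i * RootPairing.Equiv.reflection P i = 1 := by
  rw [mul_eq_one_iff_inv_eq, RootPairing.Equiv.reflection_inv P i]

lemma neg_smul_index (g : P.Aut) (i : ι) :
    g • P.reflectionPerm i i = P.reflectionPerm (g • i) (g • i) :=
  P.root.injective (by
    rw [root_smul, P.root_reflectionPerm, P.root_reflectionPerm, P.reflection_apply_self,
      P.reflection_apply_self, root_smul, smul_neg])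

end RootDatum

/-! ### Heights, sums of positive roots and coroots, and the Weyl group of Φ -/

section Base

variable {ι M N : Type*} [AddCommGroup M] [AddCommGroup N] {P : RootDatum ι M N}

/-- If the reflection in the root `j` permutes `s \ {j}`, then the sum of the coroots in `s` pairs
to `2` with the root `j`. -/
lemma pairing_sum_coroot_eq_two {s : Finset ι} {j : ι} (hj : j ∈ s)
    (h : ∀ i ∈ s, i ≠ j → P.reflectionPerm j i ∈ s ∧ P.reflectionPerm j i ≠ j) :
    P.toLinearMap (P.root j) (∑ i ∈ s, P.coroot i) = 2 := by
  classical
  -- The reflection permutes the other coroots and negates that of `j`, so the sum drops by twice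
  -- this coroot; pairing with the root `j` gives the value.
  have key : P.coreflection j (∑ i ∈ s, P.coroot i)
      = (∑ i ∈ s, P.coroot i) - (2 : ℤ) • P.coroot j := by
    rw [← Finset.add_sum_erase _ _ hj, map_add, map_sum]
    have : ∑ i ∈ s.erase j, P.coreflection j (P.coroot i) = ∑ i ∈ s.erase j, P.coroot i := by
      refine Finset.sum_bij' (fun i _ ↦ P.reflectionPerm j i) (fun i _ ↦ P.reflectionPerm j i)
        ?_ ?_ ?_ ?_ ?_
      · intro i hi
        rw [Finset.mem_erase] at hi ⊢
        exact (h i hi.2 hi.1).symm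
      · intro i hi
        rw [Finset.mem_erase] at hi ⊢
        exact (h i hi.2 hi.1).symm
      · simp
      · simp
      · simp
    rw [this, P.coreflection_apply_self]
    module
  have h := congrArg (P.toLinearMap (P.root j)) key
  rw [P.coreflection_apply] at h
  simp only [map_sub, map_smul, RootPairing.root_coroot_eq_pairing, RootPairing.pairing_same,
    smul_eq_mul] at h
  simp only [RootPairing.root'] at h
  linarith

variable (b : P.Base)

lemma isPos_neg_iff (i : ι) : b.IsPos (P.reflectionPerm i i) ↔ ¬ b.IsPos i :=
  RootPairing.Base.IsPos.neg_iff_not b i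

lemma height_neg (i : ι) : b.height (P.reflectionPerm i i) = - b.height i :=
  b.height_reflectionPerm_self i

variable [Fintype ι]

open scoped Classical in
/-- The sum of the positive coroots. -/
def posCorootSum : N := ∑ i with b.IsPos i, P.coroot i

open scoped Classical in
/-- The sum of the positive roots. -/
def posRootSum : M := ∑ i with b.IsPos i, P.root i

variable [P.IsReduced]

lemma isPos_reflectionPerm_of_ne {i j : ι} (hj : j ∈ b.support) (hi : b.IsPos i) (hij : i ≠ j) :
    b.IsPos (P.reflectionPerm j i) ∧ P.reflectionPerm j i ≠ j := by
  refine ⟨hi.reflectionPerm hj hij, fun h ↦ ?_⟩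
  have : i = P.reflectionPerm j j := (P.reflectionPerm_self j i).symm.trans (congrArg _ h)
  rw [this, isPos_neg_iff] at hi
  exact hi (b.isPos_of_mem_support hj)

lemma pairing_posCorootSum_of_mem_support {j : ι} (hj : j ∈ b.support) :
    P.toLinearMap (P.root j) (posCorootSum b) = 2 := by
  classical
  refine pairing_sum_coroot_eq_two (by simpa using b.isPos_of_mem_support hj) fun i hi hij ↦ ?_
  simpa using isPos_reflectionPerm_of_ne b hj (by simpa using hi) hij

lemma posRootSum_pairing_of_mem_support {j : ι} (hj : j ∈ b.support) :
    P.toLinearMap (posRootSum b) (P.coroot j) = 2 := by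
  classical
  refine pairing_sum_coroot_eq_two (P := P.flip) (by simpa using b.isPos_of_mem_support hj)
    fun i hi hij ↦ ?_
  simpa using isPos_reflectionPerm_of_ne b hj (by simpa using hi) hij

/-- Realizes the height as a linear form on `M`, which is what lets it descend to the coinvariants.
Both sides are additive, so simple roots suffice. -/
lemma pairing_posCorootSum (i : ι) :
    P.toLinearMap (P.root i) (posCorootSum b) = 2 * b.height i := by
  obtain ⟨f, -, -, hf⟩ := b.exists_root_eq_sum_int i
  rw [RootPairing.Base.height_eq_sum hf, hf, map_sum, LinearMap.sum_apply, Finset.mul_sum]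
  refine Finset.sum_congr rfl fun j hj ↦ ?_
  rw [map_smul, LinearMap.smul_apply, pairing_posCorootSum_of_mem_support b hj, smul_eq_mul,
    mul_comm]

omit [P.IsReduced] in
-- Converts signs of pairings with coroots into signs for the positive definite form, and back.
lemma two_mul_rootForm_root (x : M) (i : ι) :
    2 * P.RootForm x (P.root i) =
      P.toLinearMap x (P.coroot i) * P.RootForm (P.root i) (P.root i) := by
  have := congrArg (P.toLinearMap x) (P.rootForm_self_smul_coroot i)
  rw [map_smul, map_nsmul, P.toLinearMap_apply_apply_Polarization,
    show P.RootForm (P.root i) x = P.RootForm x (P.root i) from P.rootForm_symmetric.eq _ _] at this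
  simp only [smul_eq_mul, nsmul_eq_mul, Nat.cast_ofNat] at this
  rw [← this, mul_comm]

omit [P.IsReduced] in
lemma rootForm_root_self_pos (i : ι) : 0 < P.RootForm (P.root i) (P.root i) :=
  P.rootForm_pos_of_ne_zero (Submodule.subset_span ⟨i, rfl⟩) (P.ne_zero i)

omit [Fintype ι] [P.IsReduced] in
lemma exists_nat_eq_sum_of_isPos {i : ι} (hi : b.IsPos i) :
    ∃ f : ι → ℕ, P.root i = ∑ j ∈ b.support, f j • P.root j := by
  obtain ⟨f, -, hf | hf⟩ := b.exists_root_eq_sum_nat_or_neg i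
  · exact ⟨f, hf⟩
  · exfalso
    have h : P.root i = ∑ j ∈ b.support, (fun j ↦ -(f j : ℤ)) j • P.root j := by simp [hf]
    rw [b.isPos_iff, RootPairing.Base.height_eq_sum h] at hi
    refine absurd hi (not_lt.mpr (Finset.sum_nonpos fun j _ ↦ by simp))

/-- The sum of the positive roots has positive `RootForm` product with each simple root, hence with
each nonzero nonnegative combination of simple roots. -/
lemma posRootSum_pairing_pos {i : ι} (hi : b.IsPos i) :
    0 < P.toLinearMap (posRootSum b) (P.coroot i) := by
  have hpos (j : ι) (hj : j ∈ b.support) : 0 < P.RootForm (posRootSum b) (P.root j) := by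
    have h := two_mul_rootForm_root (P := P) (posRootSum b) j
    rw [posRootSum_pairing_of_mem_support b hj] at h
    linarith [rootForm_root_self_pos (P := P) j]
  have : 0 < P.RootForm (posRootSum b) (P.root i) := by
    obtain ⟨f, hf⟩ := exists_nat_eq_sum_of_isPos b hi
    have hne : ∃ j ∈ b.support, f j ≠ 0 := by
      by_contra! h
      exact P.ne_zero i (by rw [hf]; exact Finset.sum_eq_zero fun j hj ↦ by simp [h j hj])
    obtain ⟨j, hj, hj0⟩ := hne
    rw [hf, map_sum]
    refine Finset.sum_pos' (fun k hk ↦ ?_) ⟨j, hj, ?_⟩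
    · rw [map_nsmul]; exact nsmul_nonneg (hpos k hk).le _
    · rw [map_nsmul]; exact nsmul_pos (hpos j hj) hj0
  have h := two_mul_rootForm_root (P := P) (posRootSum b) i
  have hi' := rootForm_root_self_pos (P := P) i
  by_contra! hle
  nlinarith

/-- The deletion property: if a product of simple reflections sends the simple root `j` to a
negative root, then multiplying it by the reflection in `j` makes it shorter. -/
lemma exists_shorter_word (l : List ι) (hl : ∀ i ∈ l, i ∈ b.support) {j : ι} (hj : j ∈ b.support)
    (h : ¬ b.IsPos ((l.map (RootPairing.Equiv.reflection P)).prod • j)) :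
    ∃ l' : List ι, (∀ i ∈ l', i ∈ b.support) ∧ l'.length < l.length ∧
      (l'.map (RootPairing.Equiv.reflection P)).prod =
        (l.map (RootPairing.Equiv.reflection P)).prod * RootPairing.Equiv.reflection P j := by
  induction l with
  | nil => exact absurd (b.isPos_of_mem_support hj) (by simpa using h)
  | cons i t ih =>
    simp only [List.mem_cons, forall_eq_or_imp] at hl
    by_cases ht : b.IsPos ((t.map (RootPairing.Equiv.reflection P)).prod • j)
    · refine ⟨t, hl.2, by simp, ?_⟩
      have hij : (t.map (RootPairing.Equiv.reflection P)).prod • j = i := by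
        by_contra hne
        refine h ?_
        rw [List.map_cons, List.prod_cons, mul_smul]
        exact ht.reflectionPerm hl.1 hne
      rw [List.map_cons, List.prod_cons, mul_assoc, smul_reflection_mul, hij, ← mul_assoc,
        reflection_mul_self, one_mul]
    · obtain ⟨t', h1, h2, h3⟩ := ih hl.2 ht
      refine ⟨i :: t', ?_, by simpa using h2, ?_⟩
      · simpa using ⟨hl.1, h1⟩
      · simp only [List.map_cons, List.prod_cons]
        rw [h3, mul_assoc]

/-- The Weyl group is generated by the simple reflections. -/
lemma exists_word_of_mem_weylGroup {w : P.Aut} (hw : w ∈ P.weylGroup) :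
    ∃ l : List ι, (∀ i ∈ l, i ∈ b.support) ∧
      (l.map (RootPairing.Equiv.reflection P)).prod = w := by
  induction hw using RootPairing.weylGroup.induction with
  | mem i =>
    refine b.induction_reflect i (p := fun i ↦ ∃ l : List ι, (∀ i ∈ l, i ∈ b.support) ∧
        (l.map (RootPairing.Equiv.reflection P)).prod = RootPairing.Equiv.reflection P i)
      (fun i ⟨l, hl, h⟩ ↦ ⟨l, hl, h.trans (aut_ext fun m ↦ ?_)⟩)
      (fun i hi ↦ ⟨[i], by simpa using hi, by simp⟩) (fun i j ⟨l, hl, h⟩ hj ↦ ?_)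
    · simp [P.reflection_apply, two_smul]
    · refine ⟨j :: (l ++ [j]), by simpa [or_imp, forall_and] using ⟨hj, hl, hj⟩, ?_⟩
      have := smul_reflection_mul (RootPairing.Equiv.reflection P j) i
      rw [List.map_cons, List.prod_cons, List.map_append, List.prod_append, h, List.map_singleton,
        List.prod_singleton, ← mul_assoc, this, mul_assoc, reflection_mul_self, mul_one]
      rfl
  | one => exact ⟨[], by simp, by simp⟩
  | mul x y hx hy ihx ihy =>
    obtain ⟨l, hl, rfl⟩ := ihx
    obtain ⟨l', hl', rfl⟩ := ihy
    exact ⟨l ++ l', by simpa [or_imp, forall_and] using ⟨hl, hl'⟩, by simp⟩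

/-- An element of the Weyl group that preserves the set of positive roots is trivial. -/
lemma eq_one_of_forall_isPos {w : P.Aut} (hw : w ∈ P.weylGroup)
    (h : ∀ i, b.IsPos i → b.IsPos (w • i)) : w = 1 := by
  obtain ⟨l, hl, rfl⟩ := exists_word_of_mem_weylGroup b hw
  generalize hn : l.length = n
  induction n using Nat.strong_induction_on generalizing l with
  | _ n ih =>
    rcases List.eq_nil_or_concat l with rfl | ⟨t, j, rfl⟩
    · simp
    · have hj : j ∈ b.support := hl j (by simp)
      have ht : ∀ i ∈ t, i ∈ b.support := fun i hi ↦ hl i (by simp [hi])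
      -- The whole word keeps `j` positive and its last letter negates `j`, so the prefix makes `j`
      -- negative; deletion then gives a strictly shorter word for the same element.
      have hneg : ¬ b.IsPos ((t.map (RootPairing.Equiv.reflection P)).prod • j) := by
        have := h j (b.isPos_of_mem_support hj)
        rw [List.concat_eq_append, List.map_append, List.prod_append, List.map_singleton,
          List.prod_singleton, mul_smul] at this
        change b.IsPos (_ • P.reflectionPerm j j) at this
        rwa [neg_smul_index, isPos_neg_iff] at this
      obtain ⟨t', h1, h2, h3⟩ := exists_shorter_word b t ht hj hneg
      have heq : (List.map (RootPairing.Equiv.reflection P) (t.concat j)).prod =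
          (t'.map (RootPairing.Equiv.reflection P)).prod := by
        rw [h3]; simp
      rw [heq] at h hw ⊢
      refine ih t'.length ?_ t' h1 hw h rfl
      rw [← hn, List.length_concat]; omega

end Base

/-! ### Orbits of roots and orbit sums of coroots -/

section Orbits

variable {ι M N A : Type*} [AddCommGroup M] [AddCommGroup N] [Group A] {P : RootDatum ι M N}
  {ρ : A →* P.Aut}

lemma mem_orbit_self (i : ι) : i ∈ orbit ρ i := ⟨1, by simp⟩

lemma smul_mem_orbit_self (a : A) (i : ι) : ρ a • i ∈ orbit ρ i := ⟨a, rfl⟩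

lemma mem_orbit_symm {i j : ι} (h : j ∈ orbit ρ i) : i ∈ orbit ρ j := by
  obtain ⟨a, rfl⟩ := h
  exact ⟨a⁻¹, by rw [← mul_smul, ← map_mul]; simp⟩

lemma mem_orbit_trans {i j k : ι} (h : j ∈ orbit ρ i) (h' : k ∈ orbit ρ j) : k ∈ orbit ρ i := by
  obtain ⟨a, rfl⟩ := h
  obtain ⟨c, rfl⟩ := h'
  exact ⟨c * a, by rw [map_mul, mul_smul]⟩

lemma smul_mem_orbit_iff (a : A) {i j : ι} : ρ a • j ∈ orbit ρ i ↔ j ∈ orbit ρ i :=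
  ⟨fun h ↦ mem_orbit_trans h (mem_orbit_symm ⟨a, rfl⟩), fun h ↦ mem_orbit_trans h ⟨a, rfl⟩⟩

lemma orbit_eq_of_mem {i j : ι} (h : j ∈ orbit ρ i) : orbit ρ j = orbit ρ i :=
  Set.ext fun _ ↦ ⟨mem_orbit_trans h, mem_orbit_trans (mem_orbit_symm h)⟩

/-- The roots whose image is multipliable: some conjugate pairs to `-1` with the root. -/
def Mult (ρ : A →* P.Aut) (i : ι) : Prop := ∃ j ∈ orbit ρ i, P.pairing i j = -1

/-- The roots whose image is divisible: they are the sum of two conjugate roots. -/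
def Div (ρ : A →* P.Aut) (k : ι) : Prop :=
  ∃ i, ∃ j ∈ orbit ρ i, P.root k = P.root i + P.root j

variable [Fintype ι]

open scoped Classical in
/-- The `A`-orbit of a root, as a finset. -/
def orb (ρ : A →* P.Aut) (i : ι) : Finset ι := Finset.univ.filter (· ∈ orbit ρ i)

@[simp] lemma mem_orb {i j : ι} : j ∈ orb ρ i ↔ j ∈ orbit ρ i := by simp [orb]

lemma orb_eq_of_mem {i j : ι} (h : j ∈ orbit ρ i) : orb ρ j = orb ρ i := by
  ext k; rw [mem_orb, mem_orb, orbit_eq_of_mem h]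

lemma card_orb_pos (i : ι) : 0 < (orb ρ i).card :=
  Finset.card_pos.mpr ⟨i, by simp [mem_orbit_self]⟩

lemma sum_orb_smul {X : Type*} [AddCommMonoid X] (f : ι → X) (a : A) (i : ι) :
    ∑ j ∈ orb ρ i, f (ρ a • j) = ∑ j ∈ orb ρ i, f j := by
  refine Finset.sum_equiv (MulAction.toPerm (ρ a)) (fun j ↦ ?_) (fun j _ ↦ rfl)
  simp [smul_mem_orbit_iff]

/-- Double counting along two orbits of an invariant function. -/
lemma card_smul_sum_orb {X : Type*} [AddCommMonoid X] (F : ι → ι → X)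
    (hF : ∀ a i j, F (ρ a • i) (ρ a • j) = F i j) (i j : ι) :
    (orb ρ i).card • ∑ l ∈ orb ρ j, F i l = (orb ρ j).card • ∑ k ∈ orb ρ i, F k j := by
  have h1 : ∀ k ∈ orb ρ i, ∑ l ∈ orb ρ j, F k l = ∑ l ∈ orb ρ j, F i l := by
    intro k hk
    obtain ⟨a, rfl⟩ := mem_orb.mp hk
    rw [← sum_orb_smul (fun l ↦ F (ρ a • i) l) a j]
    exact Finset.sum_congr rfl fun l _ ↦ hF a i l
  have h2 : ∀ l ∈ orb ρ j, ∑ k ∈ orb ρ i, F k l = ∑ k ∈ orb ρ i, F k j := by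
    intro k hk
    obtain ⟨a, rfl⟩ := mem_orb.mp hk
    rw [← sum_orb_smul (fun l ↦ F l (ρ a • j)) a i]
    exact Finset.sum_congr rfl fun l _ ↦ hF a l j
  rw [← Finset.sum_const, ← Finset.sum_const, ← Finset.sum_congr rfl h1,
    ← Finset.sum_congr rfl h2, Finset.sum_comm]

lemma orbitSum_eq (i : ι) : orbitSum ρ i = ∑ j ∈ orb ρ i, P.root j := rfl

/-- The sum of the coroots in the `A`-orbit of `i`. -/
def orbC (ρ : A →* P.Aut) (i : ι) : N := ∑ j ∈ orb ρ i, P.coroot j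

lemma orbC_eq_of_mem {i j : ι} (h : j ∈ orbit ρ i) : orbC ρ j = orbC ρ i := by
  rw [orbC, orb_eq_of_mem h, orbC]

omit [Fintype ι] in
lemma coweightRep_apply_coroot (a : A) (i : ι) :
    coweightRep ρ a (P.coroot i) = P.coroot (ρ a • i) := by
  have := coweightMap_coroot_smul (ρ a⁻¹) (ρ a • i)
  rw [← mul_smul, ← map_mul, inv_mul_cancel, map_one, one_smul] at this
  exact this

lemma orbC_mem_invariants (i : ι) : orbC ρ i ∈ (coweightRep ρ).invariants := by
  intro a
  simp only [orbC, map_sum, coweightRep_apply_coroot]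
  exact sum_orb_smul (fun j ↦ P.coroot j) a i

lemma smul_orbitSum (a : A) (i : ι) : ρ a • orbitSum ρ i = orbitSum ρ i := by
  rw [orbitSum_eq, Finset.smul_sum, ← sum_orb_smul (fun j ↦ P.root j) a i]
  simp [root_smul]

omit [Fintype ι] in
lemma toLinearMap_smul_of_mem_invariants {n : N} (hn : n ∈ (coweightRep ρ).invariants) (a : A)
    (m : M) : P.toLinearMap (ρ a • m) n = P.toLinearMap m n := by
  rw [toLinearMap_smul]
  congr 1
  have := hn a⁻¹
  simpa [coweightRep] using this

/-- Summing the invariant matrix of pairings over a product of two orbits in either order; the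
cardinalities appear because the orbits may differ in size. -/
lemma card_mul_toLinearMap_orbC (i j : ι) :
    (orb ρ i).card * P.toLinearMap (P.root i) (orbC ρ j) =
      (orb ρ j).card * P.toLinearMap (orbitSum ρ i) (P.coroot j) := by
  have := card_smul_sum_orb (ρ := ρ) (fun i j ↦ P.pairing i j)
    (fun a i j ↦ pairing_smul_smul (ρ a) i j) i j
  simpa [orbC, orbitSum_eq, LinearMap.sum_apply] using this

/-- The pairing of a root with the sum of the coroots in its orbit. -/
def orbSelf (ρ : A →* P.Aut) (i : ι) : ℤ := P.toLinearMap (P.root i) (orbC ρ i)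

lemma orbSelf_eq_sum (i : ι) : orbSelf ρ i = ∑ j ∈ orb ρ i, P.pairing i j := by
  simp [orbSelf, orbC]

lemma orbSelf_eq (i : ι) :
    orbSelf ρ i = P.toLinearMap (orbitSum ρ i) (P.coroot i) := by
  have := card_mul_toLinearMap_orbC (ρ := ρ) i i
  have h0 : ((orb ρ i).card : ℤ) ≠ 0 := by exact_mod_cast (card_orb_pos i).ne'
  exact mul_left_cancel₀ h0 this

/-- Conjugate roots have the same length for `RootForm`. -/
lemma pairing_comm_of_mem_orbit {i j : ι} (h : j ∈ orbit ρ i) : P.pairing i j = P.pairing j i := by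
  have hlen : P.RootForm (P.root j) (P.root j) = P.RootForm (P.root i) (P.root i) := by
    obtain ⟨a, rfl⟩ := h
    rw [P.rootForm_root_self, P.rootForm_root_self]
    refine (Fintype.sum_equiv (MulAction.toPerm (ρ a)) _ _ fun k ↦ ?_).symm
    simp [pairing_smul_smul]
  have h1 := two_mul_rootForm_root (P := P) (P.root i) j
  have h2 := two_mul_rootForm_root (P := P) (P.root j) i
  rw [show P.RootForm (P.root i) (P.root j) = P.RootForm (P.root j) (P.root i) from
    P.rootForm_symmetric.eq _ _, h2, hlen] at h1
  exact (mul_right_cancel₀ (rootForm_root_self_pos i).ne' h1).symm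

lemma orbSelf_eq_add_sum [DecidableEq ι] (i : ι) :
    orbSelf ρ i = 2 + ∑ j ∈ (orb ρ i).erase i, P.pairing i j := by
  rw [orbSelf_eq_sum, ← Finset.add_sum_erase _ _ (mem_orb.mpr (mem_orbit_self i)),
    P.pairing_same]

end Orbits

/-! ### An orbit is orthogonal or a union of A₂-pairs -/

section Positivity

variable {ι M N A : Type*} [AddCommGroup M] [AddCommGroup N] [Group A] {P : RootDatum ι M N}
  [Fintype ι] [P.IsReduced] {b : P.Base} {ρ : A →* P.Aut}
  (hρ : ∀ a, ∀ i ∈ b.support, ρ a • i ∈ b.support)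
include hρ

omit [P.IsReduced] in
lemma height_smul (a : A) (i : ι) : b.height (ρ a • i) = b.height i := by
  refine b.induction_add i (p := fun i ↦ b.height (ρ a • i) = b.height i) ?_ ?_ ?_
  · intro i hi
    rw [neg_smul_index, height_neg, height_neg, hi]
  · intro i hi
    rw [RootPairing.Base.height_one_of_mem_support (hρ a i hi),
      RootPairing.Base.height_one_of_mem_support hi]
  · intro i j k hk hi hj
    have hk' : P.root (ρ a • k) = P.root (ρ a • i) + P.root (ρ a • j) := by
      simp only [root_smul, hk, smul_add]
    rw [b.height_add hk', b.height_add hk, hi,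
      RootPairing.Base.height_one_of_mem_support (hρ a j hj),
      RootPairing.Base.height_one_of_mem_support hj]

omit [P.IsReduced] in
lemma height_of_mem_orbit {i j : ι} (h : j ∈ orbit ρ i) : b.height j = b.height i := by
  obtain ⟨a, rfl⟩ := h
  exact height_smul hρ a i

omit [P.IsReduced] in
lemma isPos_of_mem_orbit {i j : ι} (h : j ∈ orbit ρ i) : b.IsPos j ↔ b.IsPos i := by
  rw [b.isPos_iff, b.isPos_iff, height_of_mem_orbit hρ h]

omit [P.IsReduced] in
lemma posCorootSum_mem_invariants : posCorootSum b ∈ (coweightRep ρ).invariants := by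
  classical
  intro a
  simp only [posCorootSum, map_sum, coweightRep_apply_coroot]
  refine Finset.sum_equiv (MulAction.toPerm (ρ a)) (fun j ↦ ?_) (fun j _ ↦ rfl)
  simp [isPos_of_mem_orbit hρ (smul_mem_orbit_self a j)]

/-- The members of an orbit share one nonzero height, so their heights cannot cancel. -/
lemma orbitSum_ne_zero (i : ι) : orbitSum ρ i ≠ 0 := by
  intro h
  have h1 := congrArg (fun x ↦ P.toLinearMap x (posCorootSum b)) h
  simp only [orbitSum_eq, map_sum, LinearMap.sum_apply, pairing_posCorootSum, map_zero,
    LinearMap.zero_apply] at h1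
  rw [Finset.sum_congr rfl (fun j hj ↦ by rw [height_of_mem_orbit hρ (mem_orb.mp hj)]),
    Finset.sum_const, nsmul_eq_mul] at h1
  have := (card_orb_pos (ρ := ρ) i).ne'
  have := b.height_ne_zero i
  simp_all

/-- Twice the norm of the orbit sum equals `orbSelf ρ i` times the sum of the norms of the roots in
the orbit, and both norms are positive. -/
lemma orbSelf_pos (i : ι) : 0 < orbSelf ρ i := by
  have h1 : 0 < P.RootForm (orbitSum ρ i) (orbitSum ρ i) := by
    refine P.rootForm_pos_of_ne_zero ?_ (orbitSum_ne_zero hρ i)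
    exact Submodule.sum_mem _ fun j _ ↦ Submodule.subset_span ⟨j, rfl⟩
  have h2 : 2 * P.RootForm (orbitSum ρ i) (orbitSum ρ i) =
      orbSelf ρ i * ∑ j ∈ orb ρ i, P.RootForm (P.root j) (P.root j) := by
    conv_lhs => rw [orbitSum_eq, map_sum, ← orbitSum_eq, Finset.mul_sum]
    rw [Finset.mul_sum]
    refine Finset.sum_congr rfl fun j hj ↦ ?_
    rw [two_mul_rootForm_root, orbSelf_eq]
    congr 1
    obtain ⟨a, rfl⟩ := mem_orb.mp hj
    conv_lhs => rw [← smul_orbitSum a, toLinearMap_smul, coweightMap_coroot_smul]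
  have h3 : 0 < ∑ j ∈ orb ρ i, P.RootForm (P.root j) (P.root j) :=
    Finset.sum_pos (fun j _ ↦ rootForm_root_self_pos j) ⟨i, by simp [mem_orbit_self]⟩
  by_contra! h
  nlinarith

omit [P.IsReduced] in
/-- The difference of two roots of the same height is not a root. -/
lemma pairing_nonpos_of_mem_orbit {i j : ι} (h : j ∈ orbit ρ i) (hne : j ≠ i) :
    P.pairing i j ≤ 0 := by
  by_contra! hpos
  rw [← pairingIn_int] at hpos
  obtain ⟨k, hk⟩ := P.root_sub_root_mem_of_pairingIn_pos hpos hne.symm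
  have := b.height_sub hk
  rw [height_of_mem_orbit hρ h, sub_self] at this
  exact b.height_ne_zero k this

/-- `orbSelf` is positive and equals 2 plus nonpositive integers, so each of these is at least -1;
the value -1 is what `Mult` describes. -/
lemma pairing_of_not_mult {i j : ι} (hi : ¬ Mult ρ i) (h : j ∈ orbit ρ i) (hne : j ≠ i) :
    P.pairing i j = 0 := by
  classical
  have h1 := orbSelf_pos hρ i
  rw [orbSelf_eq_add_sum] at h1
  have hmem : j ∈ (orb ρ i).erase i := by simp [hne, h]
  rw [← Finset.add_sum_erase _ _ hmem] at h1
  have h2 : ∑ x ∈ ((orb ρ i).erase i).erase j, P.pairing i x ≤ 0 := by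
    refine Finset.sum_nonpos fun k hk ↦ ?_
    simp only [Finset.mem_erase, mem_orb] at hk
    exact pairing_nonpos_of_mem_orbit hρ hk.2.2 hk.2.1
  have h3 := pairing_nonpos_of_mem_orbit hρ h hne
  have h4 : P.pairing i j ≠ -1 := fun h' ↦ hi ⟨j, h, h'⟩
  omega

lemma orbSelf_of_not_mult {i : ι} (hi : ¬ Mult ρ i) : orbSelf ρ i = 2 := by
  classical
  rw [orbSelf_eq_add_sum, Finset.sum_eq_zero, add_zero]
  intro j hj
  simp only [Finset.mem_erase, mem_orb] at hj
  exact pairing_of_not_mult hρ hi hj.2 hj.1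

/-- Two negative terms would already cancel the 2 in `orbSelf`: each root has at most one partner in
its orbit. -/
lemma pairing_of_mult {i j k : ι} (hj : j ∈ orbit ρ i) (hij : P.pairing i j < 0)
    (hk : k ∈ orbit ρ i) (hki : k ≠ i) (hkj : k ≠ j) :
    P.pairing i k = 0 := by
  classical
  have h1 := orbSelf_pos hρ i
  have hji : j ≠ i := by rintro rfl; simp at hij
  rw [orbSelf_eq_add_sum] at h1
  have hmem : j ∈ (orb ρ i).erase i := by simp [hji, hj]
  have hmem' : k ∈ ((orb ρ i).erase i).erase j := by simp [hkj, hk, hki]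
  rw [← Finset.add_sum_erase _ _ hmem, ← Finset.add_sum_erase _ _ hmem'] at h1
  have h2 : ∑ x ∈ (((orb ρ i).erase i).erase j).erase k, P.pairing i x ≤ 0 := by
    refine Finset.sum_nonpos fun l hl ↦ ?_
    simp only [Finset.mem_erase, mem_orb] at hl
    exact pairing_nonpos_of_mem_orbit hρ hl.2.2.2 hl.2.2.1
  have h3 := pairing_nonpos_of_mem_orbit hρ hk hki
  omega

lemma pairing_eq_neg_one_of_neg {i j : ι} (hj : j ∈ orbit ρ i) (hij : P.pairing i j < 0) :
    P.pairing i j = -1 ∧ orbSelf ρ i = 1 := by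
  classical
  have h1 := orbSelf_pos hρ i
  have hji : j ≠ i := by rintro rfl; simp at hij
  rw [orbSelf_eq_add_sum] at h1 ⊢
  have hmem : j ∈ (orb ρ i).erase i := by simp [hji, hj]
  rw [← Finset.add_sum_erase _ _ hmem] at h1 ⊢
  have h2 : ∑ x ∈ ((orb ρ i).erase i).erase j, P.pairing i x = 0 := by
    refine Finset.sum_eq_zero fun l hl ↦ ?_
    simp only [Finset.mem_erase, mem_orb] at hl
    exact pairing_of_mult hρ hj hij hl.2.2 hl.2.1 hl.1
  omega

lemma orbSelf_of_mult {i : ι} (hi : Mult ρ i) : orbSelf ρ i = 1 := by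
  obtain ⟨j, hj, hij⟩ := hi
  exact (pairing_eq_neg_one_of_neg hρ hj (by omega)).2

end Positivity

/-! ### The perfect pairing of M_A/tor with the invariants -/

section Lattices

variable {ι M N A : Type*} [AddCommGroup M] [AddCommGroup N] [Group A] {P : RootDatum ι M N}
  (ρ : A →* P.Aut)

lemma proj_surjective : Function.Surjective (proj ρ) :=
  (Submodule.mkQ_surjective _).comp (Representation.Coinvariants.mk_surjective (weightRep ρ))

variable {ρ} in
lemma proj_smul (a : A) (m : M) : proj ρ (ρ a • m) = proj ρ m := by
  change Submodule.mkQ _ _ = Submodule.mkQ _ _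
  congr 1
  exact Representation.Coinvariants.mk_self_apply (weightRep ρ) a m

/-- The pairing of `M` with the invariants of `N`. -/
def restrictedPairing : M →ₗ[ℤ] InvLattice ρ →ₗ[ℤ] ℤ :=
  P.toLinearMap.compl₂ (coweightRep ρ).invariants.subtype

lemma restrictedPairing_comp_weightRep (a : A) :
    restrictedPairing ρ ∘ₗ weightRep ρ a = restrictedPairing ρ :=
  LinearMap.ext fun m ↦ LinearMap.ext fun n ↦ toLinearMap_smul_of_mem_invariants n.2 a m

/-- The pairing of the coinvariants of `M` with the invariants of `N`. -/
def coinvariantsPairing : (weightRep ρ).Coinvariants →ₗ[ℤ] InvLattice ρ →ₗ[ℤ] ℤ :=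
  Representation.Coinvariants.lift (weightRep ρ) (restrictedPairing ρ)
    (restrictedPairing_comp_weightRep ρ)

lemma torsion_le_ker_coinvariantsPairing :
    Submodule.torsion ℤ (weightRep ρ).Coinvariants ≤ (coinvariantsPairing ρ).ker := by
  intro x hx
  rw [Submodule.mem_torsion_iff] at hx
  obtain ⟨⟨c, hc⟩, hx⟩ := hx
  have hc0 : c ≠ 0 := nonZeroDivisors.ne_zero hc
  rw [LinearMap.mem_ker]
  ext n
  have h : c * coinvariantsPairing ρ x n = 0 := by
    have h' := congrArg (fun y ↦ coinvariantsPairing ρ y n) hx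
    simpa [Submonoid.mk_smul] using h'
  simpa [hc0] using h

/-- The pairing of the coinvariant lattice with the invariants of `N`. -/
def foldedPairing : CoinvLattice ρ →ₗ[ℤ] InvLattice ρ →ₗ[ℤ] ℤ :=
  Submodule.liftQ _ (coinvariantsPairing ρ) (torsion_le_ker_coinvariantsPairing ρ)

@[simp] lemma foldedPairing_proj (m : M) (n : InvLattice ρ) :
    foldedPairing ρ (proj ρ m) n = P.toLinearMap m n := rfl

variable [Module.Finite ℤ M]

instance : Module.Finite ℤ (CoinvLattice ρ) := Module.Finite.of_surjective _ (proj_surjective ρ)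

/-- A linear form on M_A/tor is an A-invariant form on `M`; the vector of `N` representing it is
unique, hence itself invariant. Reflexivity of the finitely generated lattice M_A/tor then makes one
bijective side enough. -/
instance : (foldedPairing ρ).IsPerfPair := by
  have : Module.IsReflexive ℤ (CoinvLattice ρ) := inferInstance
  refine LinearMap.IsPerfPair.flip (p := (foldedPairing ρ).flip)
    (LinearMap.IsPerfPair.of_bijective _ ⟨?_, ?_⟩)
  · intro x y h
    refine Subtype.ext (eq_of_toLinearMap_right (P := P) fun m ↦ ?_)
    exact LinearMap.congr_fun h (proj ρ m)
  · intro f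
    let n : N := P.flip.toPerfPair.symm (f.comp (proj ρ))
    have hn (m : M) : P.toLinearMap m n = f (proj ρ m) :=
      LinearMap.congr_fun (P.flip.toPerfPair.apply_symm_apply (f.comp (proj ρ))) m
    have hmem : n ∈ (coweightRep ρ).invariants := by
      intro a
      refine eq_of_toLinearMap_right (P := P) fun m ↦ ?_
      change P.toLinearMap m ((ρ a⁻¹).coweightMap n) = _
      rw [← toLinearMap_smul, hn, hn, proj_smul]
    refine ⟨⟨n, hmem⟩, ?_⟩
    refine LinearMap.ext fun x ↦ ?_
    obtain ⟨m, rfl⟩ := proj_surjective ρ x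
    exact hn m

end Lattices

/-! ### Sums of conjugate roots, and roots with proportional images -/

section Rays

variable {ι M N A : Type*} [AddCommGroup M] [AddCommGroup N] [Group A] {P : RootDatum ι M N}
  [Fintype ι] {ρ : A →* P.Aut}

lemma eq_zero_of_forall_coroot {x : M} (hx : x ∈ P.rootSpan ℤ)
    (h : ∀ k, P.toLinearMap x (P.coroot k) = 0) : x = 0 := by
  refine P.eq_zero_of_mem_rootSpan_of_rootForm_self_eq_zero hx ?_
  rw [P.rootForm_apply_apply]
  exact Finset.sum_eq_zero fun k _ ↦ by simp [h k]

lemma eq_zero_of_forall_root {y : N} (hy : y ∈ P.corootSpan ℤ)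
    (h : ∀ k, P.toLinearMap (P.root k) y = 0) : y = 0 :=
  eq_zero_of_forall_coroot (P := P.flip) hy h

lemma orbitSum_mem_rootSpan (i : ι) : orbitSum ρ i ∈ P.rootSpan ℤ :=
  Submodule.sum_mem _ fun j _ ↦ Submodule.subset_span ⟨j, rfl⟩

lemma orbC_mem_corootSpan (i : ι) : orbC ρ i ∈ P.corootSpan ℤ :=
  Submodule.sum_mem _ fun j _ ↦ Submodule.subset_span ⟨j, rfl⟩

omit [Fintype ι] in
lemma toLinearMap_eq_of_proj_eq {x y : M} (h : proj ρ x = proj ρ y) {n : N}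
    (hn : n ∈ (coweightRep ρ).invariants) : P.toLinearMap x n = P.toLinearMap y n := by
  have := congrArg (fun z ↦ foldedPairing ρ z ⟨n, hn⟩) h
  simpa using this

/-- An invariant vector in the root span is determined by its image in the coinvariants. -/
lemma eq_zero_of_proj_eq_zero {x : M} (hx : x ∈ P.rootSpan ℤ) (hinv : ∀ a, ρ a • x = x)
    (h : proj ρ x = 0) : x = 0 := by
  refine eq_zero_of_forall_coroot hx fun k ↦ ?_
  have h0 : P.toLinearMap x (orbC ρ k) = 0 := by
    rw [toLinearMap_eq_of_proj_eq (h.trans (map_zero _).symm) (orbC_mem_invariants k)]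
    simp
  have h1 : P.toLinearMap x (orbC ρ k) = (orb ρ k).card • P.toLinearMap x (P.coroot k) := by
    rw [orbC, map_sum]
    refine Finset.sum_eq_card_nsmul fun j hj ↦ ?_
    obtain ⟨a, rfl⟩ := mem_orb.mp hj
    conv_lhs => rw [← hinv a, toLinearMap_smul, coweightMap_coroot_smul]
  rw [h0, eq_comm, smul_eq_zero] at h1
  exact h1.resolve_left (card_orb_pos k).ne'

omit [Fintype ι] in
lemma proj_root_of_mem_orbit {i j : ι} (h : j ∈ orbit ρ i) :
    proj ρ (P.root j) = proj ρ (P.root i) := by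
  obtain ⟨a, rfl⟩ := h
  rw [root_smul, proj_smul]

lemma proj_orbitSum (i : ι) : proj ρ (orbitSum ρ i) = (orb ρ i).card • proj ρ (P.root i) := by
  rw [orbitSum_eq, map_sum]
  exact Finset.sum_eq_card_nsmul fun j hj ↦ proj_root_of_mem_orbit (mem_orb.mp hj)

omit [Fintype ι] in
lemma Mult.of_mem_orbit {i j : ι} (hi : Mult ρ i) (h : j ∈ orbit ρ i) : Mult ρ j := by
  obtain ⟨a, rfl⟩ := h
  obtain ⟨k, hk, hik⟩ := hi
  refine ⟨ρ a • k, ?_, by rwa [pairing_smul_smul]⟩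
  rw [orbit_eq_of_mem (smul_mem_orbit_self a i)]
  rwa [smul_mem_orbit_iff]

omit [Fintype ι] in
lemma mult_iff_of_mem_orbit {i j : ι} (h : j ∈ orbit ρ i) : Mult ρ j ↔ Mult ρ i :=
  ⟨fun h' ↦ h'.of_mem_orbit (mem_orbit_symm h), fun h' ↦ h'.of_mem_orbit h⟩

omit [Fintype ι] in
lemma Div.of_mem_orbit {i j : ι} (hi : Div ρ i) (h : j ∈ orbit ρ i) : Div ρ j := by
  obtain ⟨a, rfl⟩ := h
  obtain ⟨k, l, hk, hik⟩ := hi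
  refine ⟨ρ a • k, ρ a • l, ?_, by simp only [root_smul, hik, smul_add]⟩
  rw [orbit_eq_of_mem (smul_mem_orbit_self a k)]
  rwa [smul_mem_orbit_iff]

omit [Fintype ι] in
lemma div_iff_of_mem_orbit {i j : ι} (h : j ∈ orbit ρ i) : Div ρ j ↔ Div ρ i :=
  ⟨fun h' ↦ h'.of_mem_orbit (mem_orbit_symm h), fun h' ↦ h'.of_mem_orbit h⟩

variable [P.IsReduced] {b : P.Base} (hρ : ∀ a, ∀ i ∈ b.support, ρ a • i ∈ b.support)
include hρ

/-- If the sum of two conjugate roots is a root, then they span a root system of type `A₂`. -/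
lemma pairing_of_root_eq_add {i j k : ι} (hj : j ∈ orbit ρ i)
    (hk : P.root k = P.root i + P.root j) : P.pairing i j = -1 := by
  have hne : j ≠ i := by
    rintro rfl
    have : Module.IsReflexive ℤ M := .of_isPerfPair P.toLinearMap
    have : IsAddTorsionFree M := .of_isTorsionFree ℤ M
    exact P.nsmul_notMem_range_root (n := 2) (i := j) ⟨k, by rw [hk, two_nsmul]⟩
  have hle := pairing_nonpos_of_mem_orbit hρ hj hne
  refine (pairing_eq_neg_one_of_neg hρ hj (lt_of_le_of_ne hle fun h0 ↦ ?_)).1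
  have h0' := h0
  rw [pairing_comm_of_mem_orbit hj] at h0'
  -- If the two roots were orthogonal, reflecting their sum in one of them would produce their
  -- difference, a root of height 0.
  have h1 : P.root (P.reflectionPerm i k) = P.root j - P.root i := by
    rw [P.root_reflectionPerm, P.reflection_apply_root,
      P.pairing_eq_add_of_root_eq_add hk, h0', P.pairing_same, hk]
    module
  have h2 := b.height_sub h1
  rw [height_of_mem_orbit hρ hj, sub_self] at h2
  exact b.height_ne_zero _ h2

lemma coroot_of_root_eq_add {i j k : ι} (hj : j ∈ orbit ρ i)
    (hk : P.root k = P.root i + P.root j) : P.coroot k = P.coroot i + P.coroot j := by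
  have h := pairing_of_root_eq_add hρ hj hk
  have h' := h
  rw [pairing_comm_of_mem_orbit hj] at h'
  have : Module.IsReflexive ℤ N := .of_isPerfPair P.flip.toLinearMap
  have := P.smul_coroot_eq_of_root_add_root_eq (i := i) (j := j) (k := k) (m := 1) (n := 1)
    (by rw [hk, one_smul, one_smul])
  rw [h, h'] at this
  norm_num at this
  rw [← neg_inj, this]
  abel

/-- The pairings of the partners `i` and `j` with any member of their orbit add up to 2 - 1 = 1 or
to 0. A pairing of `k` with a conjugate of `k` is a sum of two such numbers, so it is never -1. -/
lemma not_mult_of_root_eq_add {i j k : ι} (hj : j ∈ orbit ρ i)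
    (hk : P.root k = P.root i + P.root j) : ¬ Mult ρ k := by
  have hij := pairing_of_root_eq_add hρ hj hk
  have hji := hij
  rw [pairing_comm_of_mem_orbit hj] at hji
  have hco := coroot_of_root_eq_add hρ hj hk
  have key (l : ι) (hl : l ∈ orbit ρ i) : 0 ≤ P.pairing i l + P.pairing j l := by
    rcases eq_or_ne l i with rfl | hli
    · rw [hji, P.pairing_same]; norm_num
    rcases eq_or_ne l j with rfl | hlj
    · rw [hij, P.pairing_same]; norm_num
    rw [pairing_of_mult hρ hj (by omega) hl hli hlj,
      pairing_of_mult hρ (mem_orbit_symm hj) (by omega) (mem_orbit_trans (mem_orbit_symm hj) hl)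
        hlj hli, add_zero]
  rintro ⟨l, ⟨a, rfl⟩, hl⟩
  have h1 : P.pairing k (ρ a • k) = (P.pairing i (ρ a • i) + P.pairing j (ρ a • i)) +
      (P.pairing i (ρ a • j) + P.pairing j (ρ a • j)) := by
    have hk' : P.root (ρ a • k) = P.root (ρ a • i) + P.root (ρ a • j) := by
      simp only [root_smul, hk, smul_add]
    have hj' : ρ a • j ∈ orbit ρ (ρ a • i) := by
      rw [orbit_eq_of_mem (smul_mem_orbit_self a i)]
      rwa [smul_mem_orbit_iff]
    simp only [← P.root_coroot_eq_pairing, coroot_of_root_eq_add hρ hj' hk', hk, map_add,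
      LinearMap.add_apply]
  have h2 := key _ (smul_mem_orbit_self a i)
  have h3 := key (ρ a • j) (by rwa [smul_mem_orbit_iff])
  omega

/-- The coroot of `k` is the sum of those of `i` and `j`, so double counting makes the two orbit
sums proportional. Both pair to 2 with the root `k`, by 2 on one side and 1 + 1 on the other, so the
factor is 1. -/
lemma orbC_of_root_eq_add {i j k : ι} (hj : j ∈ orbit ρ i)
    (hk : P.root k = P.root i + P.root j) : orbC ρ k = orbC ρ i := by
  have hij := pairing_of_root_eq_add hρ hj hk
  have hco := coroot_of_root_eq_add hρ hj hk
  have hN : Module.IsReflexive ℤ N := .of_isPerfPair P.flip.toLinearMap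
  have h1 : ((orb ρ i).card : ℤ) • orbC ρ k = (2 * (orb ρ k).card : ℤ) • orbC ρ i := by
    rw [← sub_eq_zero]
    refine eq_zero_of_forall_root (P := P) (Submodule.sub_mem _ (Submodule.smul_mem _ _
      (orbC_mem_corootSpan k)) (Submodule.smul_mem _ _ (orbC_mem_corootSpan i))) fun l ↦ ?_
    have e1 := card_mul_toLinearMap_orbC (ρ := ρ) l k
    have e2 := card_mul_toLinearMap_orbC (ρ := ρ) l i
    have e3 := card_mul_toLinearMap_orbC (ρ := ρ) l j
    rw [orbC_eq_of_mem hj, orb_eq_of_mem hj] at e3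
    rw [hco, map_add] at e1
    have hl : ((orb ρ l).card : ℤ) ≠ 0 := by exact_mod_cast (card_orb_pos l).ne'
    refine mul_left_cancel₀ hl ?_
    simp only [map_sub, map_smul, smul_eq_mul]
    linear_combination ((orb ρ i).card : ℤ) * e1 - ((orb ρ k).card : ℤ) * e2 -
      ((orb ρ k).card : ℤ) * e3
  have h2 : ((orb ρ i).card : ℤ) = 2 * (orb ρ k).card := by
    have e := congrArg (P.toLinearMap (P.root k)) h1
    have e1 : P.toLinearMap (P.root k) (orbC ρ k) = 2 :=
      orbSelf_of_not_mult hρ (not_mult_of_root_eq_add hρ hj hk)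
    have e2 : P.toLinearMap (P.root k) (orbC ρ i) = 2 := by
      have hi := orbSelf_of_mult hρ (i := i) ⟨j, hj, hij⟩
      have hj' := orbSelf_of_mult hρ (i := j) (Mult.of_mem_orbit ⟨j, hj, hij⟩ hj)
      rw [orbSelf, orbC_eq_of_mem hj] at hj'
      rw [orbSelf] at hi
      rw [hk, map_add, LinearMap.add_apply, hi, hj']; norm_num
    simp only [map_smul, e1, e2, smul_eq_mul] at e
    linarith
  rw [h2] at h1
  have hk0 : (2 * (orb ρ k).card : ℤ) ≠ 0 := by
    have := card_orb_pos (ρ := ρ) k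
    positivity
  exact smul_right_injective N hk0 h1

/-- Twice the height is the pairing with the invariant vector `posCorootSum b`. -/
lemma height_eq_of_proj_eq {i j : ι} (h : proj ρ (P.root i) = proj ρ (P.root j)) :
    b.height i = b.height j := by
  have := toLinearMap_eq_of_proj_eq h (posCorootSum_mem_invariants hρ)
  rw [pairing_posCorootSum, pairing_posCorootSum] at this
  linarith

omit [P.IsReduced] hρ in
lemma exists_sub_of_toLinearMap_orbC_pos {i j : ι}
    (h : 0 < P.toLinearMap (P.root j) (orbC ρ i)) :
    ∃ k ∈ orbit ρ i, j = k ∨ ∃ l, P.root l = P.root j - P.root k := by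
  rw [orbC, map_sum] at h
  obtain ⟨k, hk, hpos⟩ := Finset.exists_lt_of_sum_lt (s := orb ρ i) (f := fun _ ↦ (0 : ℤ))
    (by simpa using h)
  refine ⟨k, mem_orb.mp hk, or_iff_not_imp_left.mpr fun hne ↦ ?_⟩
  rw [← pairingIn_int] at hpos
  exact P.root_sub_root_mem_of_pairingIn_pos hpos hne

/-- Two roots with the same image in the coinvariants are conjugate. -/
lemma mem_orbit_of_proj_eq {i j : ι} (h : proj ρ (P.root i) = proj ρ (P.root j)) :
    j ∈ orbit ρ i := by
  have hpos := orbSelf_pos hρ i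
  rw [orbSelf, toLinearMap_eq_of_proj_eq h (orbC_mem_invariants i)] at hpos
  obtain ⟨k, hk, rfl | ⟨l, hl⟩⟩ := exists_sub_of_toLinearMap_orbC_pos hpos
  · exact hk
  · have := b.height_sub hl
    rw [height_of_mem_orbit hρ hk, height_eq_of_proj_eq hρ h, sub_self] at this
    exact absurd this (b.height_ne_zero l)

/-- If the image of the root `j` is twice that of `i`, then `j` is the sum of two conjugates
of `i`. -/
lemma exists_root_eq_add_of_proj_eq_two_smul {i j : ι}
    (h : proj ρ (P.root j) = (2 : ℤ) • proj ρ (P.root i)) :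
    ∃ k ∈ orbit ρ i, ∃ l ∈ orbit ρ k, P.root j = P.root k + P.root l := by
  rw [← map_smul] at h
  have hpos : 0 < P.toLinearMap (P.root j) (orbC ρ i) := by
    rw [toLinearMap_eq_of_proj_eq h (orbC_mem_invariants i), map_smul, LinearMap.smul_apply]
    have := orbSelf_pos hρ i
    rw [orbSelf] at this
    simpa using this
  have hht : b.height j = 2 * b.height i := by
    have := toLinearMap_eq_of_proj_eq h (posCorootSum_mem_invariants hρ)
    rw [map_smul, LinearMap.smul_apply, pairing_posCorootSum, pairing_posCorootSum] at this
    rw [smul_eq_mul] at this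
    linarith
  obtain ⟨k, hk, rfl | ⟨l, hl⟩⟩ := exists_sub_of_toLinearMap_orbC_pos hpos
  · rw [height_of_mem_orbit hρ hk] at hht
    have := b.height_ne_zero i
    omega
  -- The remainder `l` has image 2γ - γ = γ, so it is conjugate to `k`.
  · refine ⟨k, hk, l, mem_orbit_of_proj_eq hρ ?_, by rw [hl]; abel⟩
    rw [hl, map_sub, h, proj_root_of_mem_orbit hk, map_smul]
    module

/-- The images of the roots `i` and `j` are proportional; the factor is the ratio of the heights. -/
def Ray (b : P.Base) (ρ : A →* P.Aut) (i j : ι) : Prop :=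
  b.height i • proj ρ (P.root j) = b.height j • proj ρ (P.root i)

/-- An analogue of the bound on Cartan integers: the two mutual pairings with orbit sums of coroots
are positive integers whose product is the product of two `orbSelf` values, each 1 or 2. The ratio
of heights is one of these pairings divided by an `orbSelf`. -/
lemma height_of_ray {i j : ι} (hi : b.IsPos i) (hj : b.IsPos j) (h : Ray b ρ i j) :
    b.height j = b.height i ∨ b.height j = 2 * b.height i ∨ b.height i = 2 * b.height j := by
  have key (k : ι) : b.height i * P.toLinearMap (P.root j) (orbC ρ k) =
      b.height j * P.toLinearMap (P.root i) (orbC ρ k) := by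
    rw [Ray, ← map_smul (proj ρ), ← map_smul (proj ρ)] at h
    simpa using toLinearMap_eq_of_proj_eq h (orbC_mem_invariants k)
  have h1 := key i
  have h2 := key j
  change _ = _ * orbSelf ρ i at h1
  change _ * orbSelf ρ j = _ at h2
  generalize P.toLinearMap (P.root j) (orbC ρ i) = x at h1
  generalize P.toLinearMap (P.root i) (orbC ρ j) = y at h2
  rw [b.isPos_iff] at hi hj
  generalize b.height i = p at *
  generalize b.height j = q at *
  have hc (k : ι) : orbSelf ρ k = 1 ∨ orbSelf ρ k = 2 := by
    by_cases hk : Mult ρ k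
    · exact .inl (orbSelf_of_mult hρ hk)
    · exact .inr (orbSelf_of_not_mult hρ hk)
  have hx : 0 < x := by
    rcases hc i with h | h <;> rw [h] at h1 <;> nlinarith
  have hy : 0 < y := by
    rcases hc j with h | h <;> rw [h] at h2 <;> nlinarith
  have hxy : x * y = orbSelf ρ i * orbSelf ρ j := by
    have hpq : p * q ≠ 0 := by positivity
    refine mul_left_cancel₀ hpq ?_
    calc p * q * (x * y) = (p * x) * (q * y) := by ring
      _ = _ := by rw [h1, ← h2]; ring
  have hx4 : x ≤ 4 := by
    rcases hc i with h | h <;> rcases hc j with h' | h' <;> rw [h, h'] at hxy <;> nlinarith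
  rcases hc i with h | h <;> rcases hc j with h' | h' <;> rw [h, h'] at hxy <;> rw [h] at h1 <;>
    rw [h'] at h2 <;> interval_cases x <;> omega

end Rays

/-! ### Compatibility with opposite roots -/

section Negation

variable {ι M N A : Type*} [AddCommGroup M] [AddCommGroup N] [Group A] {P : RootDatum ι M N}
  {ρ : A →* P.Aut}

lemma neg_neg_index (i : ι) :
    P.reflectionPerm (P.reflectionPerm i i) (P.reflectionPerm i i) = i :=
  P.root.injective (by
    rw [P.root_reflectionPerm, P.reflection_apply_self, P.root_reflectionPerm,
      P.reflection_apply_self, neg_neg])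

lemma root_neg_index (i : ι) : P.root (P.reflectionPerm i i) = - P.root i := by
  rw [P.root_reflectionPerm, P.reflection_apply_self]

lemma coroot_neg_index (i : ι) : P.coroot (P.reflectionPerm i i) = - P.coroot i := by
  rw [P.coroot_reflectionPerm, P.coreflection_apply_self]

lemma neg_mem_orbit_neg {i j : ι} (h : j ∈ orbit ρ i) :
    P.reflectionPerm j j ∈ orbit ρ (P.reflectionPerm i i) := by
  obtain ⟨a, rfl⟩ := h
  exact ⟨a, neg_smul_index (ρ a) i⟩

lemma Mult.neg {i : ι} (h : Mult ρ i) : Mult ρ (P.reflectionPerm i i) := by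
  obtain ⟨j, hj, hij⟩ := h
  exact ⟨_, neg_mem_orbit_neg hj, by simpa using hij⟩

lemma mult_neg_iff (i : ι) : Mult ρ (P.reflectionPerm i i) ↔ Mult ρ i :=
  ⟨fun h ↦ by simpa only [neg_neg_index] using h.neg, Mult.neg⟩

lemma Div.neg {i : ι} (h : Div ρ i) : Div ρ (P.reflectionPerm i i) := by
  obtain ⟨j, k, hk, h⟩ := h
  exact ⟨_, _, neg_mem_orbit_neg hk, by simp only [root_neg_index, h]; abel⟩

lemma div_neg_iff (i : ι) : Div ρ (P.reflectionPerm i i) ↔ Div ρ i :=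
  ⟨fun h ↦ by simpa only [neg_neg_index] using h.neg, Div.neg⟩

lemma orbC_neg [Fintype ι] (i : ι) : orbC ρ (P.reflectionPerm i i) = - orbC ρ i := by
  rw [orbC, orbC, ← Finset.sum_neg_distrib]
  refine Finset.sum_bij' (fun j _ ↦ P.reflectionPerm j j) (fun j _ ↦ P.reflectionPerm j j)
    ?_ ?_ ?_ ?_ ?_
  · intro j hj
    rw [mem_orb] at hj ⊢
    simpa only [neg_neg_index] using neg_mem_orbit_neg hj
  · intro j hj
    rw [mem_orb] at hj ⊢
    exact neg_mem_orbit_neg hj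
  · exact fun j _ ↦ neg_neg_index j
  · exact fun j _ ↦ neg_neg_index j
  · intro j _
    rw [coroot_neg_index, neg_neg]

end Negation

/-! ### Equivalence classes, their types, and the folded coroots -/

section Classes

variable {ι M N A : Type*} [AddCommGroup M] [AddCommGroup N] [Group A] {P : RootDatum ι M N}
  [Fintype ι] [P.IsReduced] {ρ : A →* P.Aut}
  {b : P.Base} (hρ : ∀ a, ∀ i ∈ b.support, ρ a • i ∈ b.support)
include hρ

lemma orbitSum_pairing_posCorootSum (i : ι) :
    P.toLinearMap (orbitSum ρ i) (posCorootSum b) = 2 * ((orb ρ i).card * b.height i) := by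
  have : proj ρ (orbitSum ρ i) = proj ρ ((orb ρ i).card • P.root i) := by
    rw [proj_orbitSum, map_nsmul]
  rw [toLinearMap_eq_of_proj_eq this (posCorootSum_mem_invariants hρ), map_nsmul,
    LinearMap.smul_apply, pairing_posCorootSum, nsmul_eq_mul]
  ring

-- Proportionality can be tested on orbit sums because an invariant vector of the root span vanishes
-- once its image in M_A/tor does.
omit [P.IsReduced] hρ in
lemma ray_iff_smul_orbitSum (i j : ι) : Ray b ρ i j ↔
    ((orb ρ i).card * b.height i) • orbitSum ρ j =
      ((orb ρ j).card * b.height j) • orbitSum ρ i := by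
  have hcalc : proj ρ (((orb ρ i).card * b.height i) • orbitSum ρ j -
        ((orb ρ j).card * b.height j) • orbitSum ρ i) =
      ((orb ρ i).card * (orb ρ j).card : ℤ) •
        (b.height i • proj ρ (P.root j) - b.height j • proj ρ (P.root i)) := by
    rw [map_sub, map_smul, map_smul, proj_orbitSum, proj_orbitSum]
    module
  have hc : ((orb ρ i).card * (orb ρ j).card : ℤ) ≠ 0 := by
    have := card_orb_pos (ρ := ρ) i
    have := card_orb_pos (ρ := ρ) j
    positivity
  rw [Ray, ← sub_eq_zero, ← sub_eq_zero (a := ((orb ρ i).card * b.height i) • orbitSum ρ j)]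
  constructor
  · intro h
    refine eq_zero_of_proj_eq_zero (ρ := ρ) (Submodule.sub_mem _ (Submodule.smul_mem _ _
      (orbitSum_mem_rootSpan j)) (Submodule.smul_mem _ _ (orbitSum_mem_rootSpan i))) (fun a ↦ ?_) ?_
    · rw [smul_sub, smul_comm, smul_orbitSum, smul_comm, smul_orbitSum]
    · rw [hcalc, h, smul_zero]
  · intro h
    rw [h, map_zero] at hcalc
    exact (smul_eq_zero_iff_right hc).mp hcalc.symm

/-- Pairing with the sum of the positive coroots determines the real scalar: it is the ratio of the
total heights of the two orbits. The relation then becomes integral. -/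
lemma rel_iff_ray {i j : ι} (hi : b.IsPos i) (hj : b.IsPos j) : Rel ρ i j ↔ Ray b ρ i j := by
  rw [ray_iff_smul_orbitSum]
  have hi' : 0 < ((orb ρ i).card * b.height i : ℤ) := by
    have := card_orb_pos (ρ := ρ) i
    rw [b.isPos_iff] at hi
    positivity
  have hj' : 0 < ((orb ρ j).card * b.height j : ℤ) := by
    have := card_orb_pos (ρ := ρ) j
    rw [b.isPos_iff] at hj
    positivity
  have hli := orbitSum_pairing_posCorootSum hρ i
  have hlj := orbitSum_pairing_posCorootSum hρ j
  generalize ((orb ρ i).card * b.height i : ℤ) = p at *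
  generalize ((orb ρ j).card * b.height j : ℤ) = q at *
  constructor
  · rintro ⟨c, -, h⟩
    have key (n : N) : (P.toLinearMap (orbitSum ρ j) n : ℝ) =
        c * P.toLinearMap (orbitSum ρ i) n := by
      have := congrArg ((TensorProduct.AlgebraTensorModule.rid ℤ ℝ ℝ).toLinearMap ∘ₗ
        ((P.toLinearMap.flip n).baseChange ℝ)) h
      simpa using this
    have h1 := key (posCorootSum b)
    rw [hli, hlj] at h1
    push_cast at h1
    refine eq_of_toLinearMap_left (P := P) fun n ↦ ?_
    have h2 := key n
    simp only [map_smul, LinearMap.smul_apply, smul_eq_mul]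
    have : (p * P.toLinearMap (orbitSum ρ j) n : ℝ) = q * P.toLinearMap (orbitSum ρ i) n := by
      rw [h2]
      linear_combination (-(1 / 2) * (P.toLinearMap (orbitSum ρ i) n : ℝ)) * h1
    exact_mod_cast this
  · intro h
    have hp : (p : ℝ) ≠ 0 := by exact_mod_cast hi'.ne'
    have hq : (q : ℝ) ≠ 0 := by exact_mod_cast hj'.ne'
    refine ⟨q / p, div_ne_zero hq hp, ?_⟩
    have h1 : (p : ℝ) • ((1 : ℝ) ⊗ₜ[ℤ] orbitSum ρ j) = (q : ℝ) • ((1 : ℝ) ⊗ₜ[ℤ] orbitSum ρ i) := by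
      rw [Int.cast_smul_eq_zsmul, Int.cast_smul_eq_zsmul, ← TensorProduct.tmul_smul, h,
        TensorProduct.tmul_smul]
    rw [div_eq_inv_mul, mul_smul, ← h1, smul_smul, inv_mul_cancel₀ hp, one_smul]

lemma mem_eqvClass_iff {i j : ι} (hi : b.IsPos i) :
    j ∈ eqvClass b ρ i ↔ b.IsPos j ∧ Ray b ρ i j := by
  rw [eqvClass, Set.mem_ofPred_eq]
  exact and_congr_right fun hj ↦ rel_iff_ray hρ hi hj

lemma ray_cases {i j : ι} (hi : b.IsPos i) (hj : b.IsPos j) (h : Ray b ρ i j) :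
    j ∈ orbit ρ i ∨ (∃ k ∈ orbit ρ i, ∃ l ∈ orbit ρ k, P.root j = P.root k + P.root l) ∨
      (∃ k ∈ orbit ρ j, ∃ l ∈ orbit ρ k, P.root i = P.root k + P.root l) := by
  have hi0 := b.height_ne_zero i
  have hj0 := b.height_ne_zero j
  rcases height_of_ray hρ hi hj h with h' | h' | h'
  · left
    rw [Ray, h'] at h
    exact mem_orbit_of_proj_eq hρ (smul_right_injective _ hi0 h).symm
  · right; left
    refine exists_root_eq_add_of_proj_eq_two_smul hρ (smul_right_injective _ hi0 ?_)
    rw [Ray, h'] at h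
    change b.height i • _ = b.height i • _
    rw [h]; module
  · right; right
    refine exists_root_eq_add_of_proj_eq_two_smul hρ (smul_right_injective _ hj0 ?_)
    rw [Ray, h'] at h
    change b.height j • _ = b.height j • _
    rw [← h]; module

omit [P.IsReduced] in
lemma ray_of_mem_orbit {i j : ι} (h : j ∈ orbit ρ i) : Ray b ρ i j := by
  rw [Ray, proj_root_of_mem_orbit h, height_of_mem_orbit hρ h]

omit [Fintype ι] [P.IsReduced] hρ in
lemma proj_of_root_eq_add {i j k : ι} (hj : j ∈ orbit ρ i) (hk : P.root k = P.root i + P.root j) :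
    proj ρ (P.root k) = (2 : ℤ) • proj ρ (P.root i) := by
  rw [hk, map_add, proj_root_of_mem_orbit hj, two_smul]

omit [P.IsReduced] in
lemma height_of_root_eq_add {i j k : ι} (hj : j ∈ orbit ρ i)
    (hk : P.root k = P.root i + P.root j) : b.height k = 2 * b.height i := by
  rw [b.height_add hk, height_of_mem_orbit hρ hj, two_mul]

omit [P.IsReduced] in
lemma isPos_of_root_eq_add {i j k : ι} (hj : j ∈ orbit ρ i)
    (hk : P.root k = P.root i + P.root j) : b.IsPos k ↔ b.IsPos i := by
  rw [b.isPos_iff, b.isPos_iff, height_of_root_eq_add hρ hj hk]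
  omega

/-- An image half that of `i` cannot occur, since `i` would then be both a sum of conjugates and
multipliable. -/
lemma eqvClass_of_root_eq_add {i j k : ι} (hi : b.IsPos i) (hj : j ∈ orbit ρ i)
    (hk : P.root k = P.root i + P.root j) : eqvClass b ρ i = orbit ρ i ∪ orbit ρ k := by
  have hkpos := (isPos_of_root_eq_add hρ hj hk).mpr hi
  ext l
  rw [mem_eqvClass_iff hρ hi]
  constructor
  · rintro ⟨hl, hray⟩
    rcases ray_cases hρ hi hl hray with h | ⟨x, hx, y, hy, h⟩ | ⟨x, hx, y, hy, h⟩
    · exact .inl h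
    · refine .inr (mem_orbit_of_proj_eq hρ ?_)
      rw [proj_of_root_eq_add hj hk, proj_of_root_eq_add hy h, proj_root_of_mem_orbit hx]
    · exact absurd ⟨j, hj, pairing_of_root_eq_add hρ hj hk⟩ (not_mult_of_root_eq_add hρ hy h)
  · rintro (h | h)
    · exact ⟨(isPos_of_mem_orbit hρ h).mpr hi, ray_of_mem_orbit hρ h⟩
    · refine ⟨(isPos_of_mem_orbit hρ h).mpr hkpos, ?_⟩
      rw [Ray, proj_root_of_mem_orbit h, height_of_mem_orbit hρ h, proj_of_root_eq_add hj hk,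
        height_of_root_eq_add hρ hj hk]
      module

lemma eqvClass_eq_of_root_eq_add {i j k : ι} (hi : b.IsPos i) (hj : j ∈ orbit ρ i)
    (hk : P.root k = P.root i + P.root j) : eqvClass b ρ k = eqvClass b ρ i := by
  have hkpos := (isPos_of_root_eq_add hρ hj hk).mpr hi
  ext l
  rw [mem_eqvClass_iff hρ hi, mem_eqvClass_iff hρ hkpos, Ray, Ray, proj_of_root_eq_add hj hk,
    height_of_root_eq_add hρ hj hk, mul_smul, smul_comm (b.height l)]
  exact and_congr_right fun _ ↦ (smul_right_injective _ (two_ne_zero (α := ℤ))).eq_iff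

lemma eqvClass_of_not_mult_of_not_div {i : ι} (hi : b.IsPos i) (hm : ¬ Mult ρ i)
    (hd : ¬ Div ρ i) : eqvClass b ρ i = orbit ρ i := by
  ext l
  rw [mem_eqvClass_iff hρ hi]
  constructor
  · rintro ⟨hl, hray⟩
    rcases ray_cases hρ hi hl hray with h | ⟨x, hx, y, hy, h⟩ | ⟨x, hx, y, hy, h⟩
    · exact h
    · exact absurd (Mult.of_mem_orbit ⟨y, hy, pairing_of_root_eq_add hρ hy h⟩
        (mem_orbit_symm hx)) hm
    · exact absurd ⟨x, y, hy, h⟩ hd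
  · intro h
    exact ⟨(isPos_of_mem_orbit hρ h).mpr hi, ray_of_mem_orbit hρ h⟩

omit [P.IsReduced] in
lemma Mult.exists_root_eq_add {i : ι} (h : Mult ρ i) :
    ∃ j ∈ orbit ρ i, ∃ k, P.root k = P.root i + P.root j := by
  obtain ⟨j, hj, hij⟩ := h
  refine ⟨j, hj, ?_⟩
  refine P.root_add_root_mem_of_pairingIn_neg (by rw [pairingIn_int, hij]; norm_num) fun h ↦ ?_
  -- Conjugate roots are never opposite, as they have the same nonzero height.
  have h' : P.root i = P.root (P.reflectionPerm j j) := by rw [h, root_neg_index]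
  have := congrArg b.height (P.root.injective h')
  rw [height_neg, height_of_mem_orbit hρ hj] at this
  have := b.height_ne_zero i
  omega

lemma not_mult_and_div (i : ι) : ¬ (Mult ρ i ∧ Div ρ i) := by
  rintro ⟨hm, j, k, hk, h⟩
  exact not_mult_of_root_eq_add hρ hk h hm

/-- Replaces the type of a class by conditions on one root that are stable under A, under (W_Φ)^A
and under negation. -/
lemma isTypeII_iff {i : ι} (hi : b.IsPos i) :
    IsTypeII ρ (eqvClass b ρ i) ↔ Mult ρ i ∨ Div ρ i := by
  have key (i j k : ι) (hi : b.IsPos i) (hj : j ∈ orbit ρ i) (hk : P.root k = P.root i + P.root j) :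
      IsTypeII ρ (eqvClass b ρ i) := by
    rw [eqvClass_of_root_eq_add hρ hi hj hk]
    obtain ⟨a, rfl⟩ := hj
    refine ⟨i, k, a, hk, ?_⟩
    ext l
    constructor
    · rintro (⟨c, rfl⟩ | ⟨c, rfl⟩)
      · exact ⟨c, i, by simp, rfl⟩
      · exact ⟨c, k, by simp, rfl⟩
    · rintro ⟨c, l, rfl | rfl | rfl, rfl⟩
      · exact .inl ⟨c, rfl⟩
      · exact .inl (by rw [smul_mem_orbit_iff]; exact ⟨a, rfl⟩)
      · exact .inr ⟨c, rfl⟩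
  constructor
  · rintro ⟨j, k, a, hk, hE⟩
    have hmem : i ∈ eqvClass b ρ i :=
      (mem_eqvClass_iff hρ hi).mpr ⟨hi, ray_of_mem_orbit hρ (mem_orbit_self i)⟩
    rw [hE] at hmem
    have hm : Mult ρ j :=
      ⟨_, smul_mem_orbit_self a j, pairing_of_root_eq_add hρ (smul_mem_orbit_self a j) hk⟩
    obtain ⟨c, l, rfl | rfl | rfl, rfl⟩ := hmem
    · exact .inl (hm.of_mem_orbit (smul_mem_orbit_self _ _))
    · exact .inl (hm.of_mem_orbit (by rw [smul_mem_orbit_iff]; exact smul_mem_orbit_self _ _))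
    · exact .inr (Div.of_mem_orbit ⟨j, _, smul_mem_orbit_self a j, hk⟩ (smul_mem_orbit_self _ _))
  · rintro (h | ⟨j, k, hk, h⟩)
    · obtain ⟨j, hj, k, hk⟩ := h.exists_root_eq_add hρ
      exact key i j k hi hj hk
    · have hj := (isPos_of_root_eq_add hρ hk h).mp hi
      rw [eqvClass_eq_of_root_eq_add hρ hj hk h]
      exact key j k i hj hk h

lemma isTypeI_iff {i : ι} (hi : b.IsPos i) :
    IsTypeI ρ (eqvClass b ρ i) ↔ ¬ Mult ρ i ∧ ¬ Div ρ i := by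
  have hmem : i ∈ eqvClass b ρ i :=
    (mem_eqvClass_iff hρ hi).mpr ⟨hi, ray_of_mem_orbit hρ (mem_orbit_self i)⟩
  constructor
  · rintro ⟨⟨l, hl⟩, hsum⟩
    rw [hl] at hmem
    rw [← orbit_eq_of_mem hmem] at hl
    refine ⟨fun h ↦ ?_, fun ⟨j, k, hk, h⟩ ↦ ?_⟩
    · obtain ⟨j, hj, k, hk⟩ := h.exists_root_eq_add hρ
      rw [hl] at hsum
      exact hsum i (mem_orbit_self i) j hj ⟨k, hk⟩
    · have hj := (isPos_of_root_eq_add hρ hk h).mp hi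
      rw [eqvClass_eq_of_root_eq_add hρ hj hk h, eqvClass_of_root_eq_add hρ hj hk h] at hl
      have : j ∈ orbit ρ i := hl ▸ Or.inl (mem_orbit_self j)
      have h1 := height_of_mem_orbit hρ this
      rw [height_of_root_eq_add hρ hk h] at h1
      have := b.height_ne_zero j
      omega
  · rintro ⟨hm, hd⟩
    rw [eqvClass_of_not_mult_of_not_div hρ hi hm hd]
    refine ⟨⟨i, rfl⟩, fun j hj k hk ⟨l, hl⟩ ↦ hm ?_⟩
    have hk' := mem_orbit_trans (mem_orbit_symm hj) hk
    exact Mult.of_mem_orbit ⟨k, hk', pairing_of_root_eq_add hρ hk' hl⟩ (mem_orbit_symm hj)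

lemma isSpecial_iff {i : ι} (hi : b.IsPos i) : IsSpecial b ρ i ↔ Div ρ i := by
  constructor
  · rintro ⟨-, -, j, hj, k, hk, h⟩
    rw [mem_eqvClass_iff hρ hi] at hj hk
    have hk0 := hk.1
    have hj0 := hj.1
    have hadd := b.height_add h
    rw [b.isPos_iff] at hi hk0 hj0
    -- The heights of `j` and `k` are positive and add up to that of `i`, so `j` must have half the
    -- height of `i`.
    rcases height_of_ray hρ hi hj.1 hj.2 with h' | h' | h'
    · omega
    · omega
    · have hray := hj.2
      rw [Ray, h'] at hray
      obtain ⟨x, -, y, hy, hx⟩ := exists_root_eq_add_of_proj_eq_two_smul hρ (i := j) (j := i)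
        (smul_right_injective _ (b.height_ne_zero j) (by
          change b.height j • _ = b.height j • _
          rw [← hray]; module))
      exact ⟨x, y, hy, hx⟩
  · rintro h
    refine ⟨hi, (isTypeII_iff hρ hi).mpr (.inr h), ?_⟩
    obtain ⟨j, k, hk, h⟩ := h
    have hj := (isPos_of_root_eq_add hρ hk h).mp hi
    rw [eqvClass_eq_of_root_eq_add hρ hj hk h, eqvClass_of_root_eq_add hρ hj hk h]
    exact ⟨j, .inl (mem_orbit_self j), k, .inl hk, h⟩

open scoped Classical in
/-- The coroot of the image of the root `i`, in terms of the orbit of `i`. -/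
def orbitCoroot (ρ : A →* P.Aut) (i : ι) : N := (if Mult ρ i then 2 else 1 : ℤ) • orbC ρ i

omit [P.IsReduced] hρ in
lemma orbC_add_orbC {i k : ι} (h : k ∉ orbit ρ i) [DecidableEq ι] :
    ∑ j ∈ orb ρ i ∪ orb ρ k, P.coroot j = orbC ρ i + orbC ρ k := by
  rw [Finset.sum_union, orbC, orbC]
  rw [Finset.disjoint_left]
  intro l hl hl'
  rw [mem_orb] at hl hl'
  exact h (mem_orbit_trans hl (mem_orbit_symm hl'))

/-- The class of a multipliable root consists of two orbits with the same sum of coroots, whence the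
factor 2. The special members of such a class form one orbit, which gives the factor 1 for divisible
roots. -/
lemma posCoroot_eq {i : ι} (hi : b.IsPos i) : posCoroot b ρ i = orbitCoroot ρ i := by
  classical
  rw [posCoroot, orbitCoroot]
  by_cases hd : Div ρ i
  · have hm : ¬ Mult ρ i := fun h ↦ not_mult_and_div hρ i ⟨h, hd⟩
    rw [if_pos ((isSpecial_iff hρ hi).mpr hd), if_neg hm, one_smul, orbC]
    refine Finset.sum_congr (Finset.ext fun j ↦ ?_) fun _ _ ↦ rfl
    simp only [Finset.mem_filter, Finset.mem_univ, true_and, mem_orb]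
    obtain ⟨x, y, hy, h⟩ := hd
    have hx := (isPos_of_root_eq_add hρ hy h).mp hi
    have hmx : Mult ρ x := ⟨y, hy, pairing_of_root_eq_add hρ hy h⟩
    rw [eqvClass_eq_of_root_eq_add hρ hx hy h, eqvClass_of_root_eq_add hρ hx hy h]
    constructor
    · rintro ⟨hj | hj, hs⟩
      · rw [isSpecial_iff hρ ((isPos_of_mem_orbit hρ hj).mpr hx)] at hs
        exact absurd ⟨hmx.of_mem_orbit hj, hs⟩ (not_mult_and_div hρ j)
      · exact hj
    · intro hj
      refine ⟨.inr hj, ?_⟩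
      rw [isSpecial_iff hρ ((isPos_of_mem_orbit hρ hj).mpr hi)]
      exact Div.of_mem_orbit ⟨x, y, hy, h⟩ hj
  · rw [if_neg (fun h ↦ hd ((isSpecial_iff hρ hi).mp h))]
    by_cases hm : Mult ρ i
    · rw [if_pos hm]
      obtain ⟨j, hj, k, hk⟩ := hm.exists_root_eq_add hρ
      have hne : k ∉ orbit ρ i := fun h ↦ hd (Div.of_mem_orbit ⟨i, j, hj, hk⟩ (mem_orbit_symm h))
      -- One of the two copies of the orbit sum of `i` is turned into that of `k`, to match the
      -- decomposition of the class into two orbits.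
      rw [two_smul]
      conv_rhs => rw [← orbC_of_root_eq_add hρ hj hk, orbC_of_root_eq_add hρ hj hk]
      nth_rw 2 [← orbC_of_root_eq_add hρ hj hk]
      rw [← orbC_add_orbC hne]
      refine Finset.sum_congr (Finset.ext fun j ↦ ?_) fun _ _ ↦ rfl
      simp only [Finset.mem_filter, Finset.mem_univ, true_and, mem_orb, Finset.mem_union]
      rw [eqvClass_of_root_eq_add hρ hi hj hk, Set.mem_union]
    · rw [if_neg hm, one_smul, orbC]
      refine Finset.sum_congr (Finset.ext fun j ↦ ?_) fun _ _ ↦ rfl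
      simp only [Finset.mem_filter, Finset.mem_univ, true_and, mem_orb]
      rw [eqvClass_of_not_mult_of_not_div hρ hi hm hd]

omit [P.IsReduced] hρ in
lemma orbitCoroot_neg (i : ι) : orbitCoroot ρ (P.reflectionPerm i i) = - orbitCoroot ρ i := by
  classical
  rw [orbitCoroot, orbitCoroot, orbC_neg, smul_neg, if_congr (mult_neg_iff i) rfl rfl]

lemma foldedCoroot_eq (i : ι) : foldedCoroot b ρ i = orbitCoroot ρ i := by
  rw [foldedCoroot]
  split_ifs with hi
  · exact posCoroot_eq hρ hi
  · rw [posCoroot_eq hρ ((isPos_neg_iff b i).mpr hi), orbitCoroot_neg, neg_neg]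

omit [Fintype ι] [P.IsReduced] hρ in
lemma symmetrize_imageRoots {p : ι → Prop} (hp : ∀ i, p (P.reflectionPerm i i) ↔ p i) :
    symmetrize (imageRoots ρ {i | b.IsPos i ∧ p i}) = imageRoots ρ {i | p i} := by
  ext x
  constructor
  · rintro (⟨i, hi, rfl⟩ | ⟨i, hi, hx⟩)
    · exact ⟨i, hi.2, rfl⟩
    · refine ⟨P.reflectionPerm i i, (hp i).mpr hi.2, ?_⟩
      simp only at hx
      simp only [root_neg_index, map_neg, hx, neg_neg]
  · rintro ⟨i, hi, rfl⟩
    by_cases h : b.IsPos i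
    · exact .inl ⟨i, ⟨h, hi⟩, rfl⟩
    · refine .inr ⟨P.reflectionPerm i i, ⟨(isPos_neg_iff b i).mpr h, (hp i).mpr hi⟩, ?_⟩
      simp only [root_neg_index, map_neg]

lemma RAndnm_eq : RAndnm b ρ = imageRoots ρ {i | ¬ Mult ρ i ∧ ¬ Div ρ i} := by
  rw [← symmetrize_imageRoots (b := b) fun i ↦ by rw [mult_neg_iff, div_neg_iff], RAndnm]
  congr 2
  ext i
  exact and_congr_right fun hi ↦ isTypeI_iff hρ hi

lemma RAm_eq : RAm b ρ = imageRoots ρ {i | Mult ρ i} := by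
  rw [← symmetrize_imageRoots (b := b) fun i ↦ by rw [mult_neg_iff], RAm]
  congr 2
  ext i
  refine and_congr_right fun hi ↦ ?_
  rw [isTypeII_iff hρ hi, isSpecial_iff hρ hi]
  have := not_mult_and_div hρ i
  tauto

lemma RAd_eq : RAd b ρ = imageRoots ρ {i | Div ρ i} := by
  rw [← symmetrize_imageRoots (b := b) fun i ↦ by rw [div_neg_iff], RAd]
  congr 2
  ext i
  exact ⟨fun h ↦ ⟨h.1, (isSpecial_iff hρ h.1).mp h⟩, fun h ↦ (isSpecial_iff hρ h.1).mpr h.2⟩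

lemma RA₁_eq : RA₁ b ρ = imageRoots ρ {i | ¬ Div ρ i} := by
  rw [RA₁, RAndnm_eq hρ, RAm_eq hρ, imageRoots, imageRoots, ← Set.image_union, imageRoots]
  congr 1
  ext i
  have := not_mult_and_div hρ i
  simp only [Set.mem_union, Set.mem_ofPred_eq]
  tauto

lemma RA₂_eq : RA₂ b ρ = imageRoots ρ {i | ¬ Mult ρ i} := by
  rw [RA₂, RAndnm_eq hρ, RAd_eq hρ, imageRoots, imageRoots, ← Set.image_union, imageRoots]
  congr 1
  ext i
  have := not_mult_and_div hρ i
  simp only [Set.mem_union, Set.mem_ofPred_eq]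
  tauto

lemma RA_eq_union : RA ρ = RA₁ b ρ ∪ RA₂ b ρ := by
  rw [RA₁_eq hρ, RA₂_eq hρ, imageRoots, imageRoots, ← Set.image_union, RA, imageRoots]
  congr 1
  ext i
  have := not_mult_and_div hρ i
  simp only [Set.mem_union, Set.mem_ofPred_eq, Set.mem_univ, true_iff]
  tauto

end Classes

/-! ### Elements of (W_Φ)^A inducing the folded reflections -/

section FixedWeyl

variable {ι M N A : Type*} [AddCommGroup M] [AddCommGroup N] [Group A] {P : RootDatum ι M N}
  {ρ : A →* P.Aut}

lemma reflection_smul (i : ι) (m : M) :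
    RootPairing.Equiv.reflection P i • m = m - P.toLinearMap m (P.coroot i) • P.root i :=
  P.reflection_apply i m

/-- The product of the reflections in a set of mutually orthogonal roots. -/
lemma exists_mem_weylGroup_of_orthogonal (s : Finset ι)
    (hs : ∀ i ∈ s, ∀ j ∈ s, j ≠ i → P.pairing i j = 0) :
    ∃ w ∈ P.weylGroup, ∀ m : M,
      w • m = m - ∑ j ∈ s, P.toLinearMap m (P.coroot j) • P.root j := by
  classical
  induction s using Finset.induction_on with
  | empty => exact ⟨1, one_mem _, fun m ↦ by simp⟩
  | insert i s hi ih =>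
    obtain ⟨w, hw, hwm⟩ := ih fun j hj k hk ↦
      hs j (Finset.mem_insert_of_mem hj) k (Finset.mem_insert_of_mem hk)
    refine ⟨RootPairing.Equiv.reflection P i * w, mul_mem (P.reflection_mem_weylGroup i) hw,
      fun m ↦ ?_⟩
    have h0 :
        P.toLinearMap (∑ j ∈ s, P.toLinearMap m (P.coroot j) • P.root j) (P.coroot i) = 0 := by
      rw [map_sum, LinearMap.sum_apply]
      refine Finset.sum_eq_zero fun j hj ↦ ?_
      rw [map_smul, LinearMap.smul_apply, P.root_coroot_eq_pairing,
        hs j (Finset.mem_insert_of_mem hj) i (Finset.mem_insert_self i s)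
          (fun h ↦ hi (h ▸ hj)), smul_zero]
    rw [mul_smul, hwm, reflection_smul, map_sub, LinearMap.sub_apply, h0, sub_zero,
      Finset.sum_insert hi]
    abel

lemma smul_comm_of_mem_fixedWeyl {w : P.Aut} (hw : w ∈ fixedWeyl ρ) (a : A) (i : ι) :
    w • ρ a • i = ρ a • w • i := by
  rw [← mul_smul, ← mul_smul, Subgroup.mem_centralizer_iff.mp hw.2 (ρ a) ⟨a, rfl⟩]

lemma smul_mem_orbit_smul {w : P.Aut} (hw : w ∈ fixedWeyl ρ) {i j : ι} (h : j ∈ orbit ρ i) :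
    w • j ∈ orbit ρ (w • i) := by
  obtain ⟨a, rfl⟩ := h
  exact ⟨a, (smul_comm_of_mem_fixedWeyl hw a i).symm⟩

lemma Mult.smul {w : P.Aut} (hw : w ∈ fixedWeyl ρ) {i : ι} (h : Mult ρ i) : Mult ρ (w • i) := by
  obtain ⟨j, hj, hij⟩ := h
  exact ⟨_, smul_mem_orbit_smul hw hj, by rwa [pairing_smul_smul]⟩

lemma mult_smul_iff {w : P.Aut} (hw : w ∈ fixedWeyl ρ) (i : ι) : Mult ρ (w • i) ↔ Mult ρ i :=
  ⟨fun h ↦ by simpa using h.smul (inv_mem hw), fun h ↦ h.smul hw⟩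

lemma Div.smul {w : P.Aut} (hw : w ∈ fixedWeyl ρ) {i : ι} (h : Div ρ i) : Div ρ (w • i) := by
  obtain ⟨j, k, hk, h⟩ := h
  exact ⟨_, _, smul_mem_orbit_smul hw hk, by simp only [root_smul, h, smul_add]⟩

lemma div_smul_iff {w : P.Aut} (hw : w ∈ fixedWeyl ρ) (i : ι) : Div ρ (w • i) ↔ Div ρ i :=
  ⟨fun h ↦ by simpa using h.smul (inv_mem hw), fun h ↦ h.smul hw⟩

variable [Fintype ι]

lemma coweightMap_orbC_smul {w : P.Aut} (hw : w ∈ fixedWeyl ρ) (i : ι) :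
    w.coweightMap (orbC ρ (w • i)) = orbC ρ i := by
  rw [orbC, orbC, map_sum]
  symm
  refine Finset.sum_equiv (MulAction.toPerm w) (fun j ↦ ?_) (fun j _ ↦ ?_)
  · simp only [mem_orb, MulAction.toPerm_apply]
    exact ⟨smul_mem_orbit_smul hw, fun h ↦ by simpa using smul_mem_orbit_smul (inv_mem hw) h⟩
  · exact (coweightMap_coroot_smul w j).symm

lemma coweightMap_orbitCoroot_smul {w : P.Aut} (hw : w ∈ fixedWeyl ρ) (i : ι) :
    w.coweightMap (orbitCoroot ρ (w • i)) = orbitCoroot ρ i := by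
  classical
  rw [orbitCoroot, orbitCoroot, map_smul, coweightMap_orbC_smul hw,
    if_congr (mult_smul_iff hw i) rfl rfl]

lemma orbitCoroot_eq_of_mem {i j : ι} (h : j ∈ orbit ρ i) : orbitCoroot ρ j = orbitCoroot ρ i := by
  classical
  rw [orbitCoroot, orbitCoroot, orbC_eq_of_mem h, if_congr (mult_iff_of_mem_orbit h) rfl rfl]

lemma orbitCoroot_of_mult {i : ι} (h : Mult ρ i) : orbitCoroot ρ i = (2 : ℤ) • orbC ρ i := by
  rw [orbitCoroot, if_pos h]

lemma orbitCoroot_of_not_mult {i : ι} (h : ¬ Mult ρ i) : orbitCoroot ρ i = orbC ρ i := by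
  rw [orbitCoroot, if_neg h, one_smul]

lemma orbitCoroot_mem_invariants (i : ι) : orbitCoroot ρ i ∈ (coweightRep ρ).invariants :=
  Submodule.smul_mem _ _ (orbC_mem_invariants i)

variable [P.IsReduced] {b : P.Base} (hρ : ∀ a, ∀ i ∈ b.support, ρ a • i ∈ b.support)
include hρ

lemma toLinearMap_root_orbitCoroot (i : ι) : P.toLinearMap (P.root i) (orbitCoroot ρ i) = 2 := by
  by_cases h : Mult ρ i
  · have := orbSelf_of_mult hρ h
    rw [orbSelf] at this
    rw [orbitCoroot_of_mult h, map_smul, this]; rfl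
  · rw [orbitCoroot_of_not_mult h]
    exact orbSelf_of_not_mult hρ h

lemma orbitCoroot_eq_of_proj_eq {i j : ι} (h : proj ρ (P.root i) = proj ρ (P.root j)) :
    orbitCoroot ρ i = orbitCoroot ρ j :=
  (orbitCoroot_eq_of_mem (mem_orbit_of_proj_eq hρ h)).symm

/-- The product of the reflections in an orbit of mutually orthogonal roots. -/
lemma exists_mem_fixedWeyl_of_not_mult {i : ι} (hi : ¬ Mult ρ i) :
    ∃ w ∈ fixedWeyl ρ, ∀ m : M,
      w • m = m - ∑ j ∈ orb ρ i, P.toLinearMap m (P.coroot j) • P.root j := by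
  obtain ⟨w, hw, hwm⟩ := exists_mem_weylGroup_of_orthogonal (P := P) (orb ρ i) (by
    intro j hj k hk hkj
    rw [mem_orb] at hj hk
    exact pairing_of_not_mult hρ (fun h ↦ hi ((mult_iff_of_mem_orbit hj).mp h))
      (mem_orbit_trans (mem_orbit_symm hj) hk) hkj)
  refine ⟨w, ⟨hw, Subgroup.mem_centralizer_iff.mpr ?_⟩, hwm⟩
  rintro _ ⟨a, rfl⟩
  refine aut_ext fun m ↦ ?_
  rw [mul_smul, mul_smul, hwm, hwm, smul_sub, Finset.smul_sum,
    ← sum_orb_smul (fun j ↦ P.toLinearMap (ρ a • m) (P.coroot j) • P.root j) a i]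
  congr 1
  refine Finset.sum_congr rfl fun j _ ↦ ?_
  rw [toLinearMap_smul, coweightMap_coroot_smul, root_smul, smul_comm]

/-- The reflection of the coinvariant lattice in the image of a root comes from an element of
the Weyl group that is fixed by `A`. -/
lemma exists_mem_fixedWeyl (i : ι) : ∃ w ∈ fixedWeyl ρ, ∀ m : M,
    proj ρ (w • m) = proj ρ m - P.toLinearMap m (orbitCoroot ρ i) • proj ρ (P.root i) := by
  have key (i : ι) (hi : ¬ Mult ρ i) : ∃ w ∈ fixedWeyl ρ, ∀ m : M,
      proj ρ (w • m) = proj ρ m - P.toLinearMap m (orbC ρ i) • proj ρ (P.root i) := by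
    obtain ⟨w, hw, hwm⟩ := exists_mem_fixedWeyl_of_not_mult hρ hi
    refine ⟨w, hw, fun m ↦ ?_⟩
    rw [hwm, map_sub, map_sum, orbC, map_sum, Finset.sum_smul]
    congr 1
    refine Finset.sum_congr rfl fun j hj ↦ ?_
    rw [map_smul, proj_root_of_mem_orbit (mem_orb.mp hj)]
  by_cases h : Mult ρ i
  -- The orbit of `i` is not orthogonal, but that of the sum `k` is; doubling the root and halving
  -- the coroot leaves the reflection unchanged.
  · obtain ⟨j, hj, k, hk⟩ := h.exists_root_eq_add hρ
    obtain ⟨w, hw, hwm⟩ := key k (not_mult_of_root_eq_add hρ hj hk)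
    refine ⟨w, hw, fun m ↦ ?_⟩
    rw [hwm, orbC_of_root_eq_add hρ hj hk, proj_of_root_eq_add hj hk, orbitCoroot_of_mult h,
      map_smul, smul_smul, smul_eq_mul, mul_comm]
  · rw [orbitCoroot_of_not_mult h]
    exact key i h

end FixedWeyl

/-! ### The folded root datum of a (W_Φ)^A-stable set of roots -/

section Datum

variable {ι M N A : Type*} [AddCommGroup M] [AddCommGroup N] [Group A] {P : RootDatum ι M N}
  [Fintype ι] [Module.Finite ℤ M] [P.IsReduced] {ρ : A →* P.Aut}
  {b : P.Base} (hρ : ∀ a, ∀ i ∈ b.support, ρ a • i ∈ b.support)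

/-- The folded coroot of the image of `i`, as an invariant vector. -/
def invCoroot (ρ : A →* P.Aut) (i : ι) : InvLattice ρ :=
  ⟨orbitCoroot ρ i, orbitCoroot_mem_invariants i⟩

-- The folded reflection is induced by an element of (W_Φ)^A, and `p` is stable under that group.
omit [Module.Finite ℤ M] in
include hρ in
lemma proj_sub_smul_mem (p : ι → Prop) (hp : ∀ w ∈ fixedWeyl ρ, ∀ i, p i → p (w • i)) (i : ι) :
    Set.MapsTo (Module.preReflection (proj ρ (P.root i)) ((foldedPairing ρ).flip (invCoroot ρ i)))
      (imageRoots ρ {i | p i}) (imageRoots ρ {i | p i}) := by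
  obtain ⟨w, hw, hwm⟩ := exists_mem_fixedWeyl hρ i
  rintro _ ⟨j, hj, rfl⟩
  refine ⟨w • j, hp w hw j hj, ?_⟩
  simp only [root_smul, hwm]
  rfl

/-- A root with the given image in the coinvariant lattice. -/
def lift {s : Set ι} (x : imageRoots ρ s) : ι :=
  ((Set.mem_image _ _ _).mp x.2).choose

omit [Fintype ι] [Module.Finite ℤ M] [P.IsReduced] in
lemma lift_mem {s : Set ι} (x : imageRoots ρ s) : lift x ∈ s :=
  ((Set.mem_image _ _ _).mp x.2).choose_spec.1

omit [Fintype ι] [Module.Finite ℤ M] [P.IsReduced] in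
lemma proj_root_lift {s : Set ι} (x : imageRoots ρ s) : proj ρ (P.root (lift x)) = x :=
  ((Set.mem_image _ _ _).mp x.2).choose_spec.2

-- A reflection with given linear form that preserves a finite set of vectors containing the other
-- root determines its root: two such reflections would compose to a unipotent map.
omit [Module.Finite ℤ M] in
include hρ in
lemma invCoroot_lift_injective (p : ι → Prop) (hp : ∀ w ∈ fixedWeyl ρ, ∀ i, p i → p (w • i)) :
    Function.Injective fun x : imageRoots ρ {i | p i} ↦ invCoroot ρ (lift x) := by
  intro x y h
  have hi := toLinearMap_root_orbitCoroot hρ (lift x)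
  have hj := toLinearMap_root_orbitCoroot hρ (lift y)
  have hij : orbitCoroot ρ (lift x) = orbitCoroot ρ (lift y) := congrArg Subtype.val h
  have : IsAddTorsionFree (CoinvLattice ρ) := .of_isTorsionFree ℤ _
  have hx := proj_sub_smul_mem hρ p hp (lift x)
  have hy := proj_sub_smul_mem hρ p hp (lift y)
  have key := Module.eq_of_mapsTo_reflection_of_mem (R := ℤ)
    (Φ := imageRoots ρ {i | p i}) (Set.Finite.image _ (Set.toFinite _)) hi hj
    ((congrArg (P.toLinearMap (P.root (lift x))) hij).symm.trans hi)
    ((congrArg (P.toLinearMap (P.root (lift y))) hij).trans hj) hx hy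
    (by rw [proj_root_lift]; exact y.2)
  rw [proj_root_lift, proj_root_lift] at key
  exact Subtype.ext key

/-- The folded root datum `(M_A / tor, S, (M^∨)^A, S^∨)` for the set `S` of images of the roots
that satisfy `p`. -/
def foldedDatum (p : ι → Prop) (hp : ∀ w ∈ fixedWeyl ρ, ∀ i, p i → p (w • i)) :
    RootDatum (imageRoots ρ {i | p i}) (CoinvLattice ρ) (InvLattice ρ) :=
  have : Finite (imageRoots ρ {i | p i}) := Set.Finite.image _ (Set.toFinite _)
  RootPairing.mk' (foldedPairing ρ) ⟨Subtype.val, Subtype.val_injective⟩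
    ⟨fun x ↦ invCoroot ρ (lift x), invCoroot_lift_injective hρ p hp⟩
    (by
      intro x
      have : foldedPairing ρ (proj ρ (P.root (lift x))) (invCoroot ρ (lift x)) = 2 :=
        toLinearMap_root_orbitCoroot hρ (lift x)
      rwa [proj_root_lift] at this)
    (by
      intro x
      have := proj_sub_smul_mem hρ p hp (lift x)
      rw [proj_root_lift] at this
      simpa only [Function.Embedding.coeFn_mk, Subtype.range_val] using this)
    (by
      rintro x _ ⟨y, rfl⟩
      obtain ⟨w, hw, hwm⟩ := exists_mem_fixedWeyl hρ (lift x)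
      -- The inverse appears because `coweightMap` is contravariant: it carries the coroot of `w •
      -- i` to that of `i`.
      let z : imageRoots ρ {i | p i} :=
        ⟨proj ρ (P.root (w⁻¹ • lift y)), ⟨_, hp _ (inv_mem hw) _ (lift_mem y), rfl⟩⟩
      refine ⟨z, Subtype.ext (eq_of_toLinearMap_right (P := P) fun m ↦ ?_)⟩
      have h1 : orbitCoroot ρ (lift z) = w.coweightMap (orbitCoroot ρ (lift y)) := by
        rw [orbitCoroot_eq_of_proj_eq hρ (proj_root_lift z),
          ← coweightMap_orbitCoroot_smul hw (w⁻¹ • lift y), smul_inv_smul]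
      have h3 : foldedPairing ρ x (invCoroot ρ (lift y)) =
          P.toLinearMap (P.root (lift x)) (orbitCoroot ρ (lift y)) := by
        rw [← proj_root_lift x]; rfl
      change P.toLinearMap m (orbitCoroot ρ (lift z)) = P.toLinearMap m (orbitCoroot ρ (lift y) -
        foldedPairing ρ x (invCoroot ρ (lift y)) • orbitCoroot ρ (lift x))
      rw [h1, ← toLinearMap_smul, h3]
      have h2 := hwm m
      rw [← map_smul, ← map_sub] at h2
      rw [toLinearMap_eq_of_proj_eq h2 (orbitCoroot_mem_invariants (lift y))]
      simp only [map_sub, map_smul, LinearMap.sub_apply, LinearMap.smul_apply, smul_eq_mul]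
      ring)

lemma foldedDatum_root (p : ι → Prop) (hp : ∀ w ∈ fixedWeyl ρ, ∀ i, p i → p (w • i))
    (s : imageRoots ρ {i | p i}) : (foldedDatum hρ p hp).root s = s := rfl

lemma foldedDatum_coroot (p : ι → Prop) (hp : ∀ w ∈ fixedWeyl ρ, ∀ i, p i → p (w • i))
    (i : ι) (h : proj ρ (P.root i) ∈ imageRoots ρ {i | p i}) :
    (foldedDatum hρ p hp).coroot ⟨_, h⟩ = invCoroot ρ i :=
  Subtype.ext (orbitCoroot_eq_of_proj_eq hρ (proj_root_lift ⟨_, h⟩))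

lemma isFolded_foldedDatum (p : ι → Prop) (hp : ∀ w ∈ fixedWeyl ρ, ∀ i, p i → p (w • i)) :
    IsFolded b ρ _ (foldedDatum hρ p hp) where
  finite := Set.Finite.image _ (Set.toFinite _)
  subset := Set.image_mono (Set.subset_univ _)
  pairing _ _ := rfl
  root _ := rfl
  coroot i h := by rw [foldedDatum_coroot, foldedCoroot_eq hρ]; rfl

end Datum

/-! ### Simple roots determine simple coroots in a reduced root datum -/

lemma exists_nat_of_mem_closure_image {κ X : Type*} [AddCommMonoid X] {v : κ → X} {D : Finset κ}
    {y : X} (hy : y ∈ AddSubmonoid.closure (v '' D)) : ∃ f : κ → ℕ, y = ∑ d ∈ D, f d • v d := by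
  classical
  induction hy using AddSubmonoid.closure_induction with
  | mem y hy =>
    obtain ⟨d, hd, rfl⟩ := hy
    refine ⟨Pi.single d 1, ?_⟩
    rw [Finset.sum_eq_single_of_mem d hd fun e _ he ↦ by rw [Pi.single_eq_of_ne he, zero_smul]]
    simp
  | zero => exact ⟨0, by simp⟩
  | add x y _ _ hx hy =>
    obtain ⟨f, rfl⟩ := hx
    obtain ⟨g, rfl⟩ := hy
    exact ⟨f + g, by simp [add_smul, Finset.sum_add_distrib]⟩

section GenericBase

variable {κ X Y : Type*} [Fintype κ] [AddCommGroup X] [AddCommGroup Y] {Q : RootDatum κ X Y}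

lemma exists_pairing_pos {D : Finset κ} {n : κ → ℕ} {k : κ}
    (h : Q.root k = ∑ d ∈ D, n d • Q.root d) : ∃ d ∈ D, 0 < Q.pairing k d := by
  have hpos := rootForm_root_self_pos (P := Q) k
  nth_rw 2 [h] at hpos
  rw [map_sum] at hpos
  obtain ⟨d, hd, hlt⟩ := Finset.exists_lt_of_sum_lt (s := D) (f := fun _ ↦ (0 : ℤ))
    (by simpa using hpos)
  refine ⟨d, hd, ?_⟩
  have h1 := two_mul_rootForm_root (P := Q) (Q.root k) d
  rw [Q.root_coroot_eq_pairing] at h1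
  have h2 := rootForm_root_self_pos (P := Q) d
  have h3 : 0 < Q.RootForm (Q.root k) (Q.root d) := pos_of_mul_pos_right hlt (by positivity)
  by_contra! hle
  nlinarith

variable [Q.IsReduced]

omit [Fintype κ] in
/-- A simple reflection permutes the positive roots other than the simple root itself. -/
lemma eq_of_root_and_neg_mem_closure {D : Finset κ} (hD : LinearIndepOn ℤ Q.root (D : Set κ))
    {f : X →ₗ[ℤ] ℤ} (hf : ∀ d ∈ D, 0 < f (Q.root d)) {k d : κ} (hd : d ∈ D)
    (hk : Q.root k ∈ AddSubmonoid.closure (Q.root '' D)) {c : ℤ}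
    (hneg : -(Q.root k - c • Q.root d) ∈ AddSubmonoid.closure (Q.root '' D)) : k = d := by
  classical
  obtain ⟨n, hn⟩ := exists_nat_of_mem_closure_image hk
  obtain ⟨m, hm⟩ := exists_nat_of_mem_closure_image hneg
  -- Adding the two expansions leaves only `c` times the root `d`. Independence then kills all other
  -- coefficients, so the root `k` is a multiple of the root `d`; reducedness and `f` leave only `k
  -- = d`.
  have h0 : ∑ e ∈ D, ((n e + m e : ℤ) - if e = d then c else 0) • Q.root e = 0 := by
    simp only [sub_smul, add_smul, Finset.sum_sub_distrib, Finset.sum_add_distrib, ite_smul,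
      zero_smul, Finset.sum_ite_eq', hd, if_true, natCast_zsmul, ← hn, ← hm]
    abel
  have h1 := linearIndepOn_finset_iff.mp hD _ h0
  have h2 (e : κ) (he : e ∈ D) (hed : e ≠ d) : n e = 0 := by
    have := h1 e he
    rw [if_neg hed] at this
    omega
  rw [Finset.sum_eq_single_of_mem d hd fun e he hed ↦ by rw [h2 e he hed, zero_smul]] at hn
  have hdep : ¬ LinearIndependent ℤ ![Q.root k, Q.root d] := by
    rw [LinearIndependent.pair_iff]
    intro h
    have := h 1 (-(n d : ℤ)) (by rw [hn]; module)
    exact one_ne_zero this.1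
  rcases RootPairing.IsReduced.eq_or_eq_neg k d hdep with h | h
  · exact Q.root.injective h
  · exfalso
    have h3 := congrArg f hn
    rw [h, map_neg, map_nsmul, nsmul_eq_mul] at h3
    have := hf d hd
    nlinarith [Nat.cast_nonneg (α := ℤ) (n d)]

/-- Induction on the value of `f`: a nonsimple positive root pairs positively with some simple
coroot, and that simple reflection keeps it positive, lowers `f`, and changes its coroot by a
positive multiple of the simple one. -/
lemma coroot_mem_closure_of_root_mem_closure {D : Finset κ}
    (hD : LinearIndepOn ℤ Q.root (D : Set κ))
    {f : X →ₗ[ℤ] ℤ} (hf : ∀ d ∈ D, 0 < f (Q.root d))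
    (hQ : ∀ k, Q.root k ∈ AddSubmonoid.closure (Q.root '' D) ∨
      -Q.root k ∈ AddSubmonoid.closure (Q.root '' D)) (k : κ)
    (hk : Q.root k ∈ AddSubmonoid.closure (Q.root '' D)) :
    Q.coroot k ∈ AddSubmonoid.closure (Q.coroot '' D) := by
  induction hN : (f (Q.root k)).toNat using Nat.strong_induction_on generalizing k with
  | _ N ih =>
  subst hN
  by_cases hkD : k ∈ D
  · exact AddSubmonoid.subset_closure ⟨k, hkD, rfl⟩
  obtain ⟨n, hn⟩ := exists_nat_of_mem_closure_image hk
  obtain ⟨d, hd, hpos⟩ := exists_pairing_pos hn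
  have hpos' : 0 < Q.pairing d k := by
    rw [← pairingIn_int] at hpos ⊢
    exact (Q.zero_lt_pairingIn_iff' ℤ).mp hpos
  have hr : Q.root (Q.reflectionPerm d k) = Q.root k - Q.pairing k d • Q.root d := by
    rw [Q.root_reflectionPerm, Q.reflection_apply_root]
  have hc : Q.coroot (Q.reflectionPerm d k) = Q.coroot k - Q.pairing d k • Q.coroot d := by
    rw [Q.coroot_reflectionPerm, Q.coreflection_apply_coroot]
  have hmem : Q.root (Q.reflectionPerm d k) ∈ AddSubmonoid.closure (Q.root '' D) := by
    refine (hQ _).resolve_right fun hneg ↦ hkD ?_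
    rw [hr] at hneg
    rwa [eq_of_root_and_neg_mem_closure hD hf hd hk hneg]
  have hfd := hf d hd
  have hfk : 0 ≤ f (Q.root (Q.reflectionPerm d k)) := by
    obtain ⟨m, hm⟩ := exists_nat_of_mem_closure_image hmem
    rw [hm, map_sum]
    exact Finset.sum_nonneg fun e he ↦ by rw [map_nsmul]; exact nsmul_nonneg (hf e he).le _
  have hlt : f (Q.root (Q.reflectionPerm d k)) < f (Q.root k) := by
    rw [hr, map_sub, map_smul, smul_eq_mul]
    nlinarith
  have := ih _ (by omega) _ hmem rfl
  rw [hc] at this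
  have h2 : Q.coroot k = (Q.coroot k - Q.pairing d k • Q.coroot d) +
      (Q.pairing d k).toNat • Q.coroot d := by
    rw [← natCast_zsmul, Int.toNat_of_nonneg hpos'.le]; abel
  rw [h2]
  exact add_mem this (nsmul_mem (AddSubmonoid.subset_closure (Set.mem_image_of_mem _ hd)) _)

/-- A linearly independent set of roots that generates the roots, up to sign, also generates the
coroots up to sign. -/
lemma coroot_mem_or_neg_mem {D : Finset κ} (hD : LinearIndepOn ℤ Q.root (D : Set κ))
    {f : X →ₗ[ℤ] ℤ} (hf : ∀ d ∈ D, 0 < f (Q.root d))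
    (hQ : ∀ k, Q.root k ∈ AddSubmonoid.closure (Q.root '' D) ∨
      -Q.root k ∈ AddSubmonoid.closure (Q.root '' D)) (k : κ) :
    Q.coroot k ∈ AddSubmonoid.closure (Q.coroot '' D) ∨
      -Q.coroot k ∈ AddSubmonoid.closure (Q.coroot '' D) := by
  rcases hQ k with h | h
  · exact .inl (coroot_mem_closure_of_root_mem_closure hD hf hQ k h)
  · refine .inr ?_
    rw [← coroot_neg_index]
    refine coroot_mem_closure_of_root_mem_closure hD hf hQ _ ?_
    rwa [root_neg_index]

end GenericBase

/-! ### Reducedness of the first two folded data -/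

section Reduced

variable {ι M N A : Type*} [AddCommGroup M] [AddCommGroup N] [Group A] {P : RootDatum ι M N}
  [Fintype ι] [Module.Finite ℤ M] [P.IsReduced] {ρ : A →* P.Aut}
  {b : P.Base} (hρ : ∀ a, ∀ i ∈ b.support, ρ a • i ∈ b.support)
include hρ

omit [Module.Finite ℤ M] in
lemma ray_of_not_linearIndependent {i j : ι}
    (h : ¬ LinearIndependent ℤ ![proj ρ (P.root i), proj ρ (P.root j)]) : Ray b ρ i j := by
  rw [LinearIndependent.pair_iff] at h
  push Not at h
  obtain ⟨s, t, hst, hne⟩ := h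
  have h1 : s * b.height i + t * b.height j = 0 := by
    have e : proj ρ (s • P.root i + t • P.root j) = proj ρ 0 := by simpa using hst
    have := toLinearMap_eq_of_proj_eq e (posCorootSum_mem_invariants hρ)
    simp only [map_add, map_smul, LinearMap.add_apply, LinearMap.smul_apply, pairing_posCorootSum,
      smul_eq_mul, map_zero, LinearMap.zero_apply] at this
    linarith
  have ht : t ≠ 0 := by
    rintro rfl
    have hs : s ≠ 0 := fun hs ↦ hne hs rfl
    rw [zero_mul, add_zero] at h1
    exact (mul_ne_zero hs (b.height_ne_zero i)) h1
  refine smul_right_injective _ ht ?_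
  change t • _ = t • _
  have h2 : t • proj ρ (P.root j) = -(s • proj ρ (P.root i)) := eq_neg_of_add_eq_zero_right hst
  rw [smul_comm, h2, smul_smul, eq_comm, ← sub_eq_zero]
  have : (t * b.height j) = -(s * b.height i) := by linarith
  rw [this]
  module

-- Up to sign, proportional images agree or have ratio 2; `hex` excludes the latter by forbidding a
-- root and its sum with a conjugate from both satisfying `p`.
omit [Module.Finite ℤ M] in
lemma proj_eq_or_eq_neg_of_ray {p : ι → Prop} (hneg : ∀ i, p i → p (P.reflectionPerm i i))
    (hex : ∀ i j k, j ∈ orbit ρ i → P.root k = P.root i + P.root j → p k → ¬ p i)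
    (horb : ∀ i j, j ∈ orbit ρ i → p i → p j)
    {i j : ι} (hi : p i) (hj : p j) (h : Ray b ρ i j) :
    proj ρ (P.root i) = proj ρ (P.root j) ∨ proj ρ (P.root i) = - proj ρ (P.root j) := by
  have key (i j : ι) (hi : p i) (hj : p j) (hi' : b.IsPos i) (hj' : b.IsPos j)
      (h : Ray b ρ i j) : proj ρ (P.root i) = proj ρ (P.root j) := by
    rcases ray_cases hρ hi' hj' h with h | ⟨k, hk, l, hl, h⟩ | ⟨k, hk, l, hl, h⟩
    · exact (proj_root_of_mem_orbit h).symm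
    · exact absurd (horb _ _ hk hi) (hex k l j hl h hj)
    · exact absurd (horb _ _ hk hj) (hex k l i hl h hi)
  have hray (i j : ι) (h : Ray b ρ i j) : Ray b ρ i (P.reflectionPerm j j) := by
    rw [Ray] at h ⊢
    rw [height_neg, root_neg_index, map_neg, smul_neg, neg_smul, h]
  have hray' (i j : ι) (h : Ray b ρ i j) : Ray b ρ (P.reflectionPerm i i) j := by
    rw [Ray] at h ⊢
    rw [height_neg, root_neg_index, map_neg, smul_neg, neg_smul, h]
  by_cases hi' : b.IsPos i <;> by_cases hj' : b.IsPos j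
  · exact .inl (key i j hi hj hi' hj' h)
  · have := key i _ hi (hneg j hj) hi' ((isPos_neg_iff b j).mpr hj') (hray _ _ h)
    rw [root_neg_index, map_neg] at this
    exact .inr this
  · have := key _ j (hneg i hi) hj ((isPos_neg_iff b i).mpr hi') hj' (hray' _ _ h)
    rw [root_neg_index, map_neg] at this
    exact .inr (neg_eq_iff_eq_neg.mp this)
  · have := key _ _ (hneg i hi) (hneg j hj) ((isPos_neg_iff b i).mpr hi')
      ((isPos_neg_iff b j).mpr hj') (hray' _ _ (hray _ _ h))
    rw [root_neg_index, map_neg, root_neg_index, map_neg, neg_inj] at this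
    exact .inl this

lemma foldedDatum_isReduced {p : ι → Prop} (hp : ∀ w ∈ fixedWeyl ρ, ∀ i, p i → p (w • i))
    (hneg : ∀ i, p i → p (P.reflectionPerm i i))
    (hex : ∀ i j k, j ∈ orbit ρ i → P.root k = P.root i + P.root j → p k → ¬ p i)
    (horb : ∀ i j, j ∈ orbit ρ i → p i → p j) : (foldedDatum hρ p hp).IsReduced where
  eq_or_eq_neg x y h := by
    simp only [foldedDatum_root] at h ⊢
    rw [← proj_root_lift x, ← proj_root_lift y] at h ⊢
    exact proj_eq_or_eq_neg_of_ray hρ hneg hex horb (lift_mem x) (lift_mem y)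
      (ray_of_not_linearIndependent hρ h)

lemma div_datum_isReduced (hp : ∀ w ∈ fixedWeyl ρ, ∀ i, ¬ Div ρ i → ¬ Div ρ (w • i)) :
    (foldedDatum hρ (fun i ↦ ¬ Div ρ i) hp).IsReduced :=
  foldedDatum_isReduced hρ hp (fun i h ↦ by rwa [div_neg_iff])
    (fun i j _ hj hk h _ ↦ h ⟨i, j, hj, hk⟩) (fun i j hj h ↦ by rwa [div_iff_of_mem_orbit hj])

lemma mult_datum_isReduced (hp : ∀ w ∈ fixedWeyl ρ, ∀ i, ¬ Mult ρ i → ¬ Mult ρ (w • i)) :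
    (foldedDatum hρ (fun i ↦ ¬ Mult ρ i) hp).IsReduced :=
  foldedDatum_isReduced hρ hp (fun i h ↦ by rwa [mult_neg_iff])
    (fun i j _ hj hk _ h ↦ h ⟨j, hj, pairing_of_root_eq_add hρ hj hk⟩)
    (fun i j hj h ↦ by rwa [mult_iff_of_mem_orbit hj])

end Reduced

/-! ### Independence and positivity for orbits of simple roots -/

section SimpleRoots

variable {ι M N A : Type*} [AddCommGroup M] [AddCommGroup N] [Group A] {P : RootDatum ι M N}
  [Fintype ι] {ρ : A →* P.Aut}
  {b : P.Base} (hρ : ∀ a, ∀ i ∈ b.support, ρ a • i ∈ b.support)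
include hρ

omit [Fintype ι] in
lemma mem_support_of_mem_orbit {i j : ι} (hi : i ∈ b.support) (h : j ∈ orbit ρ i) :
    j ∈ b.support := by
  obtain ⟨a, rfl⟩ := h
  exact hρ a i hi

lemma eq_zero_of_sum_smul_sum_orb {κ V : Type*} [AddCommGroup V] {r : ι → V}
    (hr : LinearIndepOn ℤ r (b.support : Set ι)) {t : Finset κ} {j : κ → ι}
    (hj : ∀ d ∈ t, j d ∈ b.support) (hinj : ∀ d ∈ t, ∀ e ∈ t, j e ∈ orbit ρ (j d) → d = e)
    {a : κ → ℤ} (h : ∑ d ∈ t, a d • ∑ i ∈ orb ρ (j d), r i = 0) : ∀ d ∈ t, a d = 0 := by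
  classical
  have h0 : ∑ i ∈ b.support, (∑ d ∈ t, if i ∈ orb ρ (j d) then a d else 0) • r i = 0 := by
    rw [← h]
    simp only [Finset.sum_smul]
    rw [Finset.sum_comm]
    refine Finset.sum_congr rfl fun d hd ↦ ?_
    simp only [ite_smul, zero_smul, Finset.sum_ite_mem, Finset.smul_sum]
    refine Finset.sum_congr (Finset.inter_eq_right.mpr fun i hi ↦ ?_) fun _ _ ↦ rfl
    exact mem_support_of_mem_orbit hρ (hj d hd) (mem_orb.mp hi)
  intro d hd
  have h1 := linearIndepOn_finset_iff.mp hr _ h0 (j d) (hj d hd)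
  rw [Finset.sum_eq_single_of_mem d hd, if_pos (mem_orb.mpr (mem_orbit_self _))] at h1
  · exact h1
  · intro e he hed
    exact if_neg fun h ↦ hed (hinj e he d hd (mem_orb.mp h))

/-- Nonzero multiples of the images of nonconjugate simple roots are linearly independent. -/
lemma linearIndepOn_of_eq_smul_proj {κ : Type*} {t : Finset κ} {v : κ → CoinvLattice ρ}
    {j : κ → ι} {c : κ → ℤ} (hj : ∀ d ∈ t, j d ∈ b.support)
    (hinj : ∀ d ∈ t, ∀ e ∈ t, j e ∈ orbit ρ (j d) → d = e) (hc : ∀ d ∈ t, c d ≠ 0)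
    (hv : ∀ d ∈ t, v d = c d • proj ρ (P.root (j d))) : LinearIndepOn ℤ v (t : Set κ) := by
  rw [linearIndepOn_finset_iff]
  intro g hg
  -- A common multiple of all orbit sizes: after scaling by `K`, the relation lifts with integral
  -- coefficients to one between orbit sums in `M`.
  let K : ℤ := ∏ i, ((orb ρ i).card : ℤ)
  have hcard (i : ι) : ((orb ρ i).card : ℤ) ≠ 0 := by exact_mod_cast (card_orb_pos i).ne'
  have hK : K ≠ 0 := Finset.prod_ne_zero_iff.mpr fun i _ ↦ hcard i
  have hdvd (i : ι) : ∃ q : ℤ, K = (orb ρ i).card * q :=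
    Finset.dvd_prod_of_mem (fun i ↦ ((orb ρ i).card : ℤ)) (Finset.mem_univ i)
  choose q hq using hdvd
  have hq0 (i : ι) : q i ≠ 0 := fun h ↦ hK (by rw [hq i, h, mul_zero])
  have h0 : ∑ d ∈ t, (g d * c d * q (j d)) • orbitSum ρ (j d) = 0 := by
    refine eq_zero_of_proj_eq_zero (ρ := ρ) (Submodule.sum_mem _ fun d _ ↦ Submodule.smul_mem _ _
      (orbitSum_mem_rootSpan _)) (fun a ↦ ?_) ?_
    · rw [Finset.smul_sum]
      exact Finset.sum_congr rfl fun d _ ↦ by rw [smul_comm, smul_orbitSum]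
    · rw [← smul_zero K, ← hg, map_sum, Finset.smul_sum]
      refine Finset.sum_congr rfl fun d hd ↦ ?_
      rw [map_smul, proj_orbitSum, hv d hd, ← natCast_zsmul, smul_smul, smul_smul, smul_smul,
        hq (j d)]
      congr 1
      ring
  intro d hd
  have := eq_zero_of_sum_smul_sum_orb hρ b.linearIndepOn_root hj hinj h0 d hd
  simpa [hc d hd, hq0] using this

/-- Nonzero multiples of the orbit sums of nonconjugate simple coroots are linearly independent. -/
lemma linearIndepOn_of_eq_smul_orbC {κ : Type*} {t : Finset κ} {v : κ → InvLattice ρ}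
    {j : κ → ι} {c : κ → ℤ} (hj : ∀ d ∈ t, j d ∈ b.support)
    (hinj : ∀ d ∈ t, ∀ e ∈ t, j e ∈ orbit ρ (j d) → d = e) (hc : ∀ d ∈ t, c d ≠ 0)
    (hv : ∀ d ∈ t, (v d : N) = c d • orbC ρ (j d)) : LinearIndepOn ℤ v (t : Set κ) := by
  rw [linearIndepOn_finset_iff]
  intro g hg
  have h0 : ∑ d ∈ t, (g d * c d) • orbC ρ (j d) = 0 := by
    have := congrArg (Submodule.subtype _) hg
    rw [map_sum, map_zero] at this
    rw [← this]
    refine Finset.sum_congr rfl fun d hd ↦ ?_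
    rw [map_smul, Submodule.subtype_apply, hv d hd, smul_smul]
  intro d hd
  have := eq_zero_of_sum_smul_sum_orb hρ b.linearIndepOn_coroot hj hinj h0 d hd
  simpa [hc d hd] using this

omit [Fintype ι] hρ in
lemma proj_mem_closure_or_neg_mem (i : ι) : proj ρ (P.root i) ∈ AddSubmonoid.closure (ΔA b ρ) ∨
    - proj ρ (P.root i) ∈ AddSubmonoid.closure (ΔA b ρ) := by
  have key (i : ι) (hi : b.IsPos i) : proj ρ (P.root i) ∈ AddSubmonoid.closure (ΔA b ρ) := by
    obtain ⟨f, hf⟩ := exists_nat_eq_sum_of_isPos b hi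
    rw [hf, map_sum]
    refine sum_mem fun j hj ↦ ?_
    rw [map_nsmul]
    exact nsmul_mem (AddSubmonoid.subset_closure (Set.mem_image_of_mem _ hj)) _
  by_cases hi : b.IsPos i
  · exact .inl (key i hi)
  · have := key _ ((isPos_neg_iff b i).mpr hi)
    rw [root_neg_index, map_neg] at this
    exact .inr this

/-- The orbit sum of the coroots, as an invariant vector. -/
def invOrbC (ρ : A →* P.Aut) (i : ι) : InvLattice ρ := ⟨orbC ρ i, orbC_mem_invariants i⟩

-- The coefficients are constant on orbits, so the orbits can be split off one at a time.
omit hρ in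
lemma mem_closure_invOrbC_of_eq_sum {T : Finset ι} (hT : T ⊆ b.support)
    (hTρ : ∀ a, ∀ i ∈ T, ρ a • i ∈ T) {f : ι → ℕ} (hf : ∀ a, ∀ i ∈ T, f (ρ a • i) = f i)
    {y : InvLattice ρ} (hy : (y : N) = ∑ i ∈ T, f i • P.coroot i) :
    y ∈ AddSubmonoid.closure (invOrbC ρ '' b.support) := by
  classical
  induction T using Finset.strongInduction generalizing y with
  | H T ih =>
  rcases T.eq_empty_or_nonempty with rfl | ⟨i, hi⟩
  · have : y = 0 := Subtype.ext (by simpa using hy)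
    rw [this]
    exact zero_mem _
  have hsub : orb ρ i ⊆ T := by
    intro j hj
    obtain ⟨a, rfl⟩ := mem_orb.mp hj
    exact hTρ a i hi
  have hsum : ∑ j ∈ orb ρ i, f j • P.coroot j = f i • orbC ρ i := by
    rw [orbC, Finset.smul_sum]
    refine Finset.sum_congr rfl fun j hj ↦ ?_
    obtain ⟨a, rfl⟩ := mem_orb.mp hj
    rw [hf a i hi]
  have hrest := ih (T \ orb ρ i) (Finset.sdiff_ssubset hsub ⟨i, mem_orb.mpr (mem_orbit_self i)⟩)
    (Finset.sdiff_subset.trans hT)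
    (fun a j hj ↦ by
      rw [Finset.mem_sdiff, mem_orb] at hj ⊢
      exact ⟨hTρ a j hj.1, by rw [smul_mem_orbit_iff]; exact hj.2⟩)
    (fun a j hj ↦ hf a j (Finset.sdiff_subset hj)) (y := y - f i • invOrbC ρ i) (by
      rw [Submodule.coe_sub, Submodule.coe_smul_of_tower, hy, ← Finset.sum_sdiff hsub, hsum]
      exact add_sub_cancel_right _ _)
  have := add_mem hrest (nsmul_mem (AddSubmonoid.subset_closure
    (Set.mem_image_of_mem (invOrbC ρ) (hT hi))) (f i))
  rwa [sub_add_cancel] at this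

variable [P.IsReduced]

omit hρ in
lemma coroot_mem_closure_of_isPos {i : ι} (hi : b.IsPos i) :
    P.coroot i ∈ AddSubmonoid.closure (P.coroot '' b.support) := by
  refine (b.coroot_mem_or_neg_mem i).resolve_right fun h ↦ ?_
  obtain ⟨f, hf⟩ := exists_nat_of_mem_closure_image h
  have h1 := posRootSum_pairing_pos b hi
  have h2 := congrArg (P.toLinearMap (posRootSum b)) hf
  rw [map_neg, map_sum] at h2
  have h3 : 0 ≤ ∑ d ∈ b.support, P.toLinearMap (posRootSum b) (f d • P.coroot d) := by
    refine Finset.sum_nonneg fun d hd ↦ ?_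
    rw [map_nsmul]
    exact nsmul_nonneg (posRootSum_pairing_pos b
      (RootPairing.Base.isPos_of_mem_support hd)).le _
  omega

/-- Invariance of the orbit sum and independence of the simple coroots force the coefficients to be
invariant under A. -/
lemma invOrbC_mem_closure_of_isPos {i : ι} (hi : b.IsPos i) :
    invOrbC ρ i ∈ AddSubmonoid.closure (invOrbC ρ '' b.support) := by
  have hmem : orbC ρ i ∈ AddSubmonoid.closure (P.coroot '' b.support) :=
    sum_mem fun j hj ↦ coroot_mem_closure_of_isPos ((isPos_of_mem_orbit hρ (mem_orb.mp hj)).mpr hi)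
  obtain ⟨f, hf⟩ := exists_nat_of_mem_closure_image hmem
  refine mem_closure_invOrbC_of_eq_sum subset_rfl hρ (f := f) (fun a j hj ↦ ?_) hf
  have hinv := orbC_mem_invariants (ρ := ρ) i a⁻¹
  rw [hf, map_sum] at hinv
  have h1 : ∑ j ∈ b.support, (f (ρ a • j) : ℤ) • P.coroot j =
      ∑ j ∈ b.support, (f j : ℤ) • P.coroot j := by
    simp only [natCast_zsmul]
    rw [← hinv]
    refine Finset.sum_equiv (MulAction.toPerm (ρ a)) (fun j ↦ ?_) (fun j _ ↦ ?_)
    · simp only [MulAction.toPerm_apply]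
      refine ⟨hρ a j, fun h ↦ ?_⟩
      have := hρ a⁻¹ _ h
      rwa [← mul_smul, ← map_mul, inv_mul_cancel, map_one, one_smul] at this
    · rw [map_nsmul, coweightRep_apply_coroot, MulAction.toPerm_apply, ← mul_smul, ← map_mul,
        inv_mul_cancel, map_one, one_smul]
  exact_mod_cast linearIndepOn_finset_iffₛ.mp b.linearIndepOn_coroot _ _ h1 j hj

end SimpleRoots

/-! ### Bases of the folded data -/

section FoldedBases

variable {ι M N A : Type*} [AddCommGroup M] [AddCommGroup N] [Group A] {P : RootDatum ι M N}
  [Fintype ι] [P.IsReduced] {ρ : A →* P.Aut}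
  {b : P.Base} (hρ : ∀ a, ∀ i ∈ b.support, ρ a • i ∈ b.support)
include hρ

-- A sum of two conjugate roots has even height.
omit [P.IsReduced] in
lemma not_div_of_mem_support {i : ι} (hi : i ∈ b.support) : ¬ Div ρ i := by
  rintro ⟨j, k, hk, h⟩
  have := height_of_root_eq_add hρ hk h
  rw [b.height_one_of_mem_support hi] at this
  omega

lemma mem_ΔA₂_iff {x : CoinvLattice ρ} : x ∈ ΔA₂ b ρ ↔
    ∃ j ∈ b.support, ¬ Mult ρ j ∧ x = proj ρ (P.root j) ∨
      Mult ρ j ∧ x = (2 : ℤ) • proj ρ (P.root j) := by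
  rw [ΔA₂, RAndnm_eq hρ, RAm_eq hρ]
  constructor
  · rintro (⟨⟨j, hj, rfl⟩, ⟨k, hk, h⟩⟩ | ⟨_, ⟨⟨j, hj, rfl⟩, ⟨k, hk, h⟩⟩, rfl⟩)
    · refine ⟨j, hj, .inl ⟨?_, rfl⟩⟩
      rw [mult_iff_of_mem_orbit (mem_orbit_of_proj_eq hρ h)]
      exact hk.1
    · refine ⟨j, hj, .inr ⟨?_, rfl⟩⟩
      rw [mult_iff_of_mem_orbit (mem_orbit_of_proj_eq hρ h)]
      exact hk
  · rintro ⟨j, hj, ⟨hm, rfl⟩ | ⟨hm, rfl⟩⟩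
    · exact .inl ⟨⟨j, hj, rfl⟩, ⟨j, ⟨hm, not_div_of_mem_support hρ hj⟩, rfl⟩⟩
    · exact .inr ⟨_, ⟨⟨j, hj, rfl⟩, ⟨j, hm, rfl⟩⟩, rfl⟩

omit [P.IsReduced] in
lemma linearIndepOn_id_ΔA : LinearIndepOn ℤ id (ΔA b ρ) := by
  -- The choice of simple roots below is a function on the whole lattice, which needs a default
  -- index.
  rcases isEmpty_or_nonempty ι with hι | hι
  · rw [show ΔA b ρ = ∅ from Set.eq_empty_of_forall_notMem fun _ ⟨i, _⟩ ↦ isEmptyElim i]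
    exact linearIndepOn_empty ℤ id
  have hfin : (ΔA b ρ).Finite := Set.Finite.image _ (Finset.finite_toSet _)
  rw [← hfin.coe_toFinset]
  have hΔ (x : CoinvLattice ρ) (hx : x ∈ hfin.toFinset) :
      ∃ j ∈ b.support, proj ρ (P.root j) = x := by
    rwa [hfin.mem_toFinset] at hx
  choose! j hj hjx using hΔ
  refine linearIndepOn_of_eq_smul_proj hρ hj (fun d hd e he h ↦ ?_) (c := 1) (by simp) (by
    intro d hd
    simp [hjx d hd])
  rw [← hjx d hd, ← hjx e he, proj_root_of_mem_orbit h]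

variable [Module.Finite ℤ M]

lemma foldedDatum_coroot_of_eq {p : ι → Prop} (hp : ∀ w ∈ fixedWeyl ρ, ∀ i, p i → p (w • i))
    {x : imageRoots ρ {i | p i}} {i : ι} (h : proj ρ (P.root i) = x) :
    (foldedDatum hρ p hp).coroot x = invCoroot ρ i := by
  obtain ⟨x, hx⟩ := x
  subst h
  exact foldedDatum_coroot hρ p hp i hx

lemma isBasis_foldedDatum (hp : ∀ w ∈ fixedWeyl ρ, ∀ i : ι, i ∈ Set.univ → w • i ∈ Set.univ) :
    IsBasis (foldedDatum hρ (fun i ↦ i ∈ Set.univ) hp) (ΔA b ρ) where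
  subset_range := by
    rintro _ ⟨i, -, rfl⟩
    exact ⟨⟨_, ⟨i, trivial, rfl⟩⟩, rfl⟩
  linearIndep := linearIndepOn_id_ΔA hρ
  mem_or_neg_mem k := by
    rw [foldedDatum_root, ← proj_root_lift k]
    exact proj_mem_closure_or_neg_mem _

/-- The sign condition for roots is inherited from Φ by projection; the one for coroots follows from
it, with the height as positive functional. -/
lemma exists_base_not_div (hp : ∀ w ∈ fixedWeyl ρ, ∀ i, ¬ Div ρ i → ¬ Div ρ (w • i)) :
    ∃ b₁ : (foldedDatum hρ (fun i ↦ ¬ Div ρ i) hp).Base,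
      (foldedDatum hρ (fun i ↦ ¬ Div ρ i) hp).root '' b₁.support = ΔA b ρ := by
  set Q := foldedDatum hρ (fun i ↦ ¬ Div ρ i) hp with hQ
  have : Finite (imageRoots ρ {i | ¬ Div ρ i}) := Set.Finite.image _ (Set.toFinite _)
  have : Fintype (imageRoots ρ {i | ¬ Div ρ i}) := Fintype.ofFinite _
  have : Q.IsReduced := div_datum_isReduced hρ hp
  let D : Finset (imageRoots ρ {i | ¬ Div ρ i}) := (Set.toFinite {x | x.1 ∈ ΔA b ρ}).toFinset
  have hD : Q.root '' D = ΔA b ρ := by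
    ext x
    simp only [D, Set.Finite.coe_toFinset]
    constructor
    · rintro ⟨x, hx, rfl⟩
      exact hx
    · rintro ⟨i, hi, rfl⟩
      exact ⟨⟨_, ⟨i, not_div_of_mem_support hρ hi, rfl⟩⟩, ⟨i, hi, rfl⟩, rfl⟩
  have hΔ (x : imageRoots ρ {i | ¬ Div ρ i}) :
      ∃ j, x ∈ D → j ∈ b.support ∧ proj ρ (P.root j) = x := by
    by_cases hx : x ∈ D
    · rw [Set.Finite.mem_toFinset] at hx
      obtain ⟨j, hj⟩ := hx
      exact ⟨j, fun _ ↦ hj⟩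
    · exact ⟨lift x, fun h ↦ absurd h hx⟩
  choose j hj' using hΔ
  have hj (d) (hd : d ∈ D) := (hj' d hd).1
  have hjx (d) (hd : d ∈ D) := (hj' d hd).2
  have hinj (d) (hd : d ∈ D) (e) (he : e ∈ D) (h : j e ∈ orbit ρ (j d)) : d = e := by
    rw [Subtype.ext_iff, ← hjx d hd, ← hjx e he, proj_root_of_mem_orbit h]
  have hlin : LinearIndepOn ℤ Q.root (D : Set _) :=
    linearIndepOn_of_eq_smul_proj hρ hj hinj (c := 1) (by simp) (by
      intro d hd
      rw [Pi.one_apply, one_smul, hjx d hd, hQ, foldedDatum_root])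
  have hroot (k) : Q.root k ∈ AddSubmonoid.closure (Q.root '' D) ∨
      -Q.root k ∈ AddSubmonoid.closure (Q.root '' D) := by
    rw [hD, hQ, foldedDatum_root, ← proj_root_lift k]
    exact proj_mem_closure_or_neg_mem _
  classical
  refine ⟨⟨D, hlin, ?_, hroot, ?_⟩, hD⟩
  · refine linearIndepOn_of_eq_smul_orbC hρ hj hinj
      (c := fun d ↦ if Mult ρ (j d) then 2 else 1) (fun d _ ↦ by split_ifs <;> simp)
      (fun d hd ↦ ?_)
    rw [hQ, foldedDatum_coroot_of_eq hρ hp (hjx d hd)]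
    change orbitCoroot ρ (j d) = _
    rw [orbitCoroot]
  · refine coroot_mem_or_neg_mem hlin
      (f := (foldedPairing ρ).flip ⟨posCorootSum b, posCorootSum_mem_invariants hρ⟩) ?_ hroot
    intro d hd
    rw [hQ, foldedDatum_root, ← hjx d hd]
    change 0 < P.toLinearMap (P.root (j d)) (posCorootSum b)
    rw [pairing_posCorootSum, b.height_one_of_mem_support (hj d hd)]
    norm_num

/-- Here the argument starts with the coroots. They are plain orbit sums, hence signed combinations
of the simple ones, whereas projecting Φ does not show that the coefficients of a doubled simple
root are integral. The roots follow by duality, in the flipped datum. -/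
lemma exists_base_not_mult (hp : ∀ w ∈ fixedWeyl ρ, ∀ i, ¬ Mult ρ i → ¬ Mult ρ (w • i)) :
    ∃ b₂ : (foldedDatum hρ (fun i ↦ ¬ Mult ρ i) hp).Base,
      (foldedDatum hρ (fun i ↦ ¬ Mult ρ i) hp).root '' b₂.support = ΔA₂ b ρ := by
  set Q := foldedDatum hρ (fun i ↦ ¬ Mult ρ i) hp with hQ
  have : Finite (imageRoots ρ {i | ¬ Mult ρ i}) := Set.Finite.image _ (Set.toFinite _)
  have : Fintype (imageRoots ρ {i | ¬ Mult ρ i}) := Fintype.ofFinite _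
  have : Q.IsReduced := mult_datum_isReduced hρ hp
  let D : Finset (imageRoots ρ {i | ¬ Mult ρ i}) := (Set.toFinite {x | x.1 ∈ ΔA₂ b ρ}).toFinset
  classical
  let c (i : ι) : ℤ := if Mult ρ i then 2 else 1
  have hc0 (i : ι) : c i ≠ 0 := by dsimp only [c]; split_ifs <;> norm_num
  have hc {i k : ι} (h : k ∈ orbit ρ i) : c k = c i :=
    if_congr (mult_iff_of_mem_orbit h) rfl rfl
  have hΔ (x : CoinvLattice ρ) : x ∈ ΔA₂ b ρ ↔
      ∃ j ∈ b.support, c j • proj ρ (P.root j) = x := by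
    rw [mem_ΔA₂_iff hρ]
    refine exists_congr fun j ↦ and_congr_right fun _ ↦ ?_
    by_cases h : Mult ρ j
    · simp [c, h, eq_comm]
    · simp [c, h, eq_comm]
  have hsimple (j : ι) : ∃ i, ¬ Mult ρ i ∧ proj ρ (P.root i) = c j • proj ρ (P.root j) ∧
      orbitCoroot ρ i = orbC ρ j := by
    by_cases h : Mult ρ j
    · obtain ⟨l, hl, k, hk⟩ := h.exists_root_eq_add hρ
      have hnm := not_mult_of_root_eq_add hρ hl hk
      refine ⟨k, hnm, ?_, ?_⟩
      · rw [proj_of_root_eq_add hl hk]; simp [c, h]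
      · rw [orbitCoroot_of_not_mult hnm, orbC_of_root_eq_add hρ hl hk]
    · exact ⟨j, h, by simp [c, h], orbitCoroot_of_not_mult h⟩
  have hcoroot (x : imageRoots ρ {i | ¬ Mult ρ i}) (j : ι) (h : c j • proj ρ (P.root j) = x) :
      Q.coroot x = invOrbC ρ j := by
    obtain ⟨i, -, hi, hi'⟩ := hsimple j
    rw [hQ, foldedDatum_coroot_of_eq hρ hp (hi.trans h)]
    exact Subtype.ext hi'
  have hD : Q.root '' D = ΔA₂ b ρ := by
    ext x
    simp only [D, Set.Finite.coe_toFinset]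
    constructor
    · rintro ⟨x, hx, rfl⟩
      exact hx
    · intro hx
      obtain ⟨j, -, rfl⟩ := (hΔ x).mp hx
      obtain ⟨i, hi, hij, -⟩ := hsimple j
      exact ⟨⟨_, ⟨i, hi, hij⟩⟩, hx, rfl⟩
  have hDΔ (x : imageRoots ρ {i | ¬ Mult ρ i}) :
      ∃ j, x ∈ D → j ∈ b.support ∧ c j • proj ρ (P.root j) = x := by
    by_cases hx : x ∈ D
    · rw [Set.Finite.mem_toFinset, Set.mem_ofPred_eq, hΔ] at hx
      obtain ⟨j, hj⟩ := hx
      exact ⟨j, fun _ ↦ hj⟩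
    · exact ⟨lift x, fun h ↦ absurd h hx⟩
  choose j hj' using hDΔ
  have hj (d) (hd : d ∈ D) := (hj' d hd).1
  have hjx (d) (hd : d ∈ D) := (hj' d hd).2
  have hinj (d) (hd : d ∈ D) (e) (he : e ∈ D) (h : j e ∈ orbit ρ (j d)) : d = e := by
    rw [Subtype.ext_iff, ← hjx d hd, ← hjx e he, proj_root_of_mem_orbit h, hc h]
  have hlin : LinearIndepOn ℤ Q.root (D : Set _) :=
    linearIndepOn_of_eq_smul_proj hρ hj hinj (fun d _ ↦ hc0 (j d)) (by
      intro d hd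
      rw [hjx d hd, hQ, foldedDatum_root])
  have hlin' : LinearIndepOn ℤ Q.coroot (D : Set _) :=
    linearIndepOn_of_eq_smul_orbC hρ hj hinj (c := 1) (by simp) (by
      intro d hd
      rw [Pi.one_apply, one_smul, hcoroot d _ (hjx d hd)]
      rfl)
  have hsub : AddSubmonoid.closure (invOrbC ρ '' b.support) ≤
      AddSubmonoid.closure (Q.coroot '' D) := by
    refine AddSubmonoid.closure_mono ?_
    rintro _ ⟨k, hk, rfl⟩
    have hmem : c k • proj ρ (P.root k) ∈ Q.root '' D := hD ▸ (hΔ _).mpr ⟨k, hk, rfl⟩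
    obtain ⟨x, hx, hxk⟩ := hmem
    exact ⟨x, hx, hcoroot x k hxk.symm⟩
  have hco (k) : Q.coroot k ∈ AddSubmonoid.closure (Q.coroot '' D) ∨
      -Q.coroot k ∈ AddSubmonoid.closure (Q.coroot '' D) := by
    have hk : Q.coroot k = invOrbC ρ (lift k) := by
      rw [hQ, foldedDatum_coroot_of_eq hρ hp (proj_root_lift k)]
      exact Subtype.ext (orbitCoroot_of_not_mult (lift_mem k))
    rw [hk]
    by_cases h : b.IsPos (lift k)
    · exact .inl (hsub (invOrbC_mem_closure_of_isPos hρ h))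
    · refine .inr (hsub ?_)
      have := invOrbC_mem_closure_of_isPos hρ ((isPos_neg_iff b _).mpr h)
      convert this
      exact Subtype.ext (orbC_neg _).symm
  have : Module.IsReflexive ℤ (InvLattice ρ) := .of_isPerfPair Q.flip.toLinearMap
  have : Q.flip.IsReduced := inferInstance
  refine ⟨⟨D, hlin, hlin', ?_, hco⟩, hD⟩
  refine coroot_mem_or_neg_mem (Q := Q.flip) hlin' (f := foldedPairing ρ (proj ρ (posRootSum b)))
    ?_ hco
  intro d hd
  change 0 < foldedPairing ρ _ (Q.coroot d)
  rw [hcoroot d _ (hjx d hd)]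
  change 0 < P.toLinearMap (posRootSum b) (orbC ρ (j d))
  rw [orbC, map_sum]
  refine Finset.sum_pos (fun i hi ↦ posRootSum_pairing_pos b ?_)
    (Finset.card_pos.mp (card_orb_pos _))
  exact RootPairing.Base.isPos_of_mem_support
    (mem_support_of_mem_orbit hρ (hj d hd) (mem_orb.mp hi))

end FoldedBases

/-! ### The Weyl groups of the folded data -/

section WeylGroup

variable {ι M N A : Type*} [AddCommGroup M] [AddCommGroup N] [Group A] {P : RootDatum ι M N}
  [Fintype ι] [P.IsReduced] {ρ : A →* P.Aut}

/-- The products of the reflections in the orbits of mutually orthogonal roots. -/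
def orbitReflections (ρ : A →* P.Aut) : Set P.Aut :=
  {w | w ∈ fixedWeyl ρ ∧ ∃ i, ¬ Mult ρ i ∧
    ∀ m : M, w • m = m - ∑ j ∈ orb ρ i, P.toLinearMap m (P.coroot j) • P.root j}

variable {b : P.Base} (hρ : ∀ a, ∀ i ∈ b.support, ρ a • i ∈ b.support)

lemma smul_posRootSum_pairing_posCorootSum (b : P.Base) (v : P.Aut) [DecidablePred b.IsPos] :
    P.toLinearMap (v • posRootSum b) (posCorootSum b) =
      ∑ i with b.IsPos i, 2 * b.height (v • i) := by
  rw [posRootSum, Finset.smul_sum, map_sum, LinearMap.sum_apply]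
  refine Finset.sum_congr (by ext; simp) fun i _ ↦ ?_
  rw [← root_smul, pairing_posCorootSum]

lemma smul_posRootSum_pairing_posCorootSum_le (b : P.Base) (v : P.Aut) :
    P.toLinearMap (v • posRootSum b) (posCorootSum b) ≤ ∑ i, |2 * b.height i| := by
  classical
  rw [smul_posRootSum_pairing_posCorootSum]
  calc ∑ i with b.IsPos i, 2 * b.height (v • i)
      ≤ ∑ i with b.IsPos i, |2 * b.height (v • i)| := Finset.sum_le_sum fun i _ ↦ le_abs_self _
    _ ≤ ∑ i, |2 * b.height (v • i)| :=
      Finset.sum_le_sum_of_subset_of_nonneg (Finset.filter_subset _ _) fun i _ _ ↦ abs_nonneg _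
    _ = ∑ i, |2 * b.height i| :=
      Fintype.sum_equiv (MulAction.toPerm v) _ (fun i ↦ |2 * b.height i|) fun i ↦ rfl

include hρ

/-- A multipliable root may be replaced by its sum with its partner, which has the same sign before
and after applying `v`. -/
lemma exists_not_mult_of_not_isPos_smul {v : P.Aut} (hv : v ∈ fixedWeyl ρ) {i : ι}
    (hi : b.IsPos i) (hvi : ¬ b.IsPos (v • i)) :
    ∃ k, ¬ Mult ρ k ∧ b.IsPos k ∧ ¬ b.IsPos (v • k) := by
  by_cases h : Mult ρ i
  · obtain ⟨j, hj, k, hk⟩ := h.exists_root_eq_add hρ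
    refine ⟨k, not_mult_of_root_eq_add hρ hj hk, (isPos_of_root_eq_add hρ hj hk).mpr hi, ?_⟩
    rwa [isPos_of_root_eq_add hρ (smul_mem_orbit_smul hv hj)
      (by rw [root_smul, hk, smul_add, root_smul, root_smul])]
  · exact ⟨i, h, hi, hvi⟩

/-- Acting by `w` subtracts positive multiples of the roots in the orbit of `i`, all of which `v`
makes negative. -/
lemma lt_smul_posRootSum_pairing {v w : P.Aut} (hv : v ∈ fixedWeyl ρ) {i : ι}
    (hi : b.IsPos i) (hvi : ¬ b.IsPos (v • i))
    (hw : ∀ m : M, w • m = m - ∑ j ∈ orb ρ i, P.toLinearMap m (P.coroot j) • P.root j) :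
    P.toLinearMap (v • posRootSum b) (posCorootSum b) <
      P.toLinearMap ((v * w) • posRootSum b) (posCorootSum b) := by
  rw [mul_smul, hw, smul_sub, map_sub, LinearMap.sub_apply, Finset.smul_sum, map_sum,
    LinearMap.sum_apply, lt_sub_comm, sub_self]
  refine Finset.sum_neg (fun j hj ↦ ?_) (Finset.card_pos.mp (card_orb_pos _))
  rw [mem_orb] at hj
  rw [smul_comm, map_smul, LinearMap.smul_apply, ← root_smul, pairing_posCorootSum, smul_eq_mul]
  have h1 := posRootSum_pairing_pos b ((isPos_of_mem_orbit hρ hj).mpr hi)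
  have h2 : ¬ b.IsPos (v • j) := by rwa [isPos_of_mem_orbit hρ (smul_mem_orbit_smul hv hj)]
  rw [b.isPos_iff] at h2
  have h3 := b.height_ne_zero (v • j)
  exact mul_neg_of_pos_of_neg h1 (by omega)

/-- The group `(W_Φ)^A` is generated by the products of the reflections in the orbits of mutually
orthogonal roots. -/
lemma mem_closure_orbitReflections {v : P.Aut} (hv : v ∈ fixedWeyl ρ) :
    v ∈ Subgroup.closure (orbitReflections ρ) := by
  -- The pairing is an integer bounded by this sum, uniformly in `v`, and increases with each orbit
  -- reflection; so the process stops.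
  induction hn : (∑ i, |2 * b.height i| -
    P.toLinearMap (v • posRootSum b) (posCorootSum b)).toNat using Nat.strong_induction_on
    generalizing v with
  | _ n ih =>
  subst hn
  by_cases h : ∃ i, b.IsPos i ∧ ¬ b.IsPos (v • i)
  · obtain ⟨i, hi, hvi⟩ := h
    obtain ⟨k, hk, hkpos, hvk⟩ := exists_not_mult_of_not_isPos_smul hρ hv hi hvi
    obtain ⟨w, hw, hwm⟩ := exists_mem_fixedWeyl_of_not_mult hρ hk
    have hlt := lt_smul_posRootSum_pairing hρ hv hkpos hvk hwm
    have hle := smul_posRootSum_pairing_posCorootSum_le b (v * w)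
    have h1 := ih _ (by omega) (mul_mem hv hw) rfl
    have h2 : w ∈ Subgroup.closure (orbitReflections ρ) :=
      Subgroup.subset_closure ⟨hw, k, hk, hwm⟩
    exact (Subgroup.mul_mem_cancel_right _ h2).mp h1
  · push Not at h
    rw [eq_one_of_forall_isPos b hv.1 h]
    exact one_mem _

/-- The action of `(W_Φ)^A` on the coinvariant lattice is faithful. -/
lemma eq_one_of_forall_proj_smul {w : P.Aut} (hw : w ∈ fixedWeyl ρ)
    (h : ∀ m : M, proj ρ (w • m) = proj ρ m) : w = 1 := by
  refine eq_one_of_forall_isPos b hw.1 fun i hi ↦ ?_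
  have := h (P.root i)
  rw [← root_smul] at this
  rw [b.isPos_iff] at hi ⊢
  rwa [height_eq_of_proj_eq hρ this]

variable [Module.Finite ℤ M]

/-- `hpart` says that each generating orbit reflection of (W_Φ)^A induces the reflection in some
root of the datum. Conversely every reflection of the datum lifts to (W_Φ)^A, and faithfulness makes
the correspondence bijective. -/
lemma hasWeylGroup_foldedDatum {p : ι → Prop} (hp : ∀ w ∈ fixedWeyl ρ, ∀ i, p i → p (w • i))
    (hpart : ∀ i, ¬ Mult ρ i → ∃ k, p k ∧ ∀ m : M,
      P.toLinearMap m (orbitCoroot ρ k) • proj ρ (P.root k) =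
        P.toLinearMap m (orbC ρ i) • proj ρ (P.root i)) :
    HasWeylGroup ρ (foldedDatum hρ p hp) := by
  set Q := foldedDatum hρ p hp with hQ
  have hrefl (x : imageRoots ρ {i | p i}) (k : ι) (hx : proj ρ (P.root k) = x) (m : M) :
      RootPairing.Equiv.reflection Q x • proj ρ m =
        proj ρ m - P.toLinearMap m (orbitCoroot ρ k) • proj ρ (P.root k) := by
    rw [reflection_smul, hQ, foldedDatum_coroot_of_eq hρ hp hx, foldedDatum_root, hx]
    rfl
  have hforward (w : P.Aut) (hw : w ∈ fixedWeyl ρ) :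
      ∃ q ∈ Q.weylGroup, ∀ m : M, q • proj ρ m = proj ρ (w • m) := by
    have hw' := mem_closure_orbitReflections hρ hw
    clear hw
    induction hw' using Subgroup.closure_induction with
    | mem w hw =>
      obtain ⟨-, i, hi, hwm⟩ := hw
      obtain ⟨k, hk, hki⟩ := hpart i hi
      refine ⟨_, Q.reflection_mem_weylGroup ⟨_, ⟨k, hk, rfl⟩⟩, fun m ↦ ?_⟩
      rw [hrefl _ k rfl, hki, hwm, map_sub, map_sum, orbC, map_sum, Finset.sum_smul]
      congr 1
      refine Finset.sum_congr rfl fun j hj ↦ ?_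
      rw [map_smul, proj_root_of_mem_orbit (mem_orb.mp hj)]
    | one => exact ⟨1, one_mem _, fun m ↦ by simp⟩
    | mul v w _ _ hv hw =>
      obtain ⟨q, hq, hqm⟩ := hv
      obtain ⟨r, hr, hrm⟩ := hw
      exact ⟨q * r, mul_mem hq hr, fun m ↦ by rw [mul_smul, mul_smul, hrm, hqm]⟩
    | inv w _ hw =>
      obtain ⟨q, hq, hqm⟩ := hw
      exact ⟨q⁻¹, inv_mem hq, fun m ↦ by rw [inv_smul_eq_iff, hqm, smul_inv_smul]⟩
  have hbackward (q : Q.Aut) (hq : q ∈ Q.weylGroup) :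
      ∃ w ∈ fixedWeyl ρ, ∀ m : M, q • proj ρ m = proj ρ (w • m) := by
    induction hq using RootPairing.weylGroup.induction with
    | mem x =>
      obtain ⟨w, hw, hwm⟩ := exists_mem_fixedWeyl hρ (lift x)
      exact ⟨w, hw, fun m ↦ by rw [hrefl x _ (proj_root_lift x), hwm]⟩
    | one => exact ⟨1, one_mem _, fun m ↦ by simp⟩
    | mul q r _ _ hq hr =>
      obtain ⟨v, hv, hvm⟩ := hq
      obtain ⟨w, hw, hwm⟩ := hr
      exact ⟨v * w, mul_mem hv hw, fun m ↦ by rw [mul_smul, mul_smul, hwm, hvm]⟩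
  choose e he hem using hforward
  have hext {q r : Q.Aut} (h : ∀ m : M, q • proj ρ m = r • proj ρ m) : q = r :=
    aut_ext fun x ↦ by obtain ⟨m, rfl⟩ := proj_surjective ρ x; exact h m
  let E : fixedWeyl ρ →* Q.weylGroup := MonoidHom.mk' (fun w ↦ ⟨e w w.2, he w w.2⟩)
    fun v w ↦ Subtype.ext (hext fun m ↦ by
      change e _ _ • proj ρ m = (e _ _ * e _ _) • proj ρ m
      rw [mul_smul, hem, hem, hem, ← mul_smul]
      rfl)
  have hE : Function.Bijective E := by
    refine ⟨(injective_iff_map_eq_one E).mpr fun w hw ↦ ?_, fun q ↦ ?_⟩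
    · refine Subtype.ext (eq_one_of_forall_proj_smul hρ w.2 fun m ↦ ?_)
      rw [← hem w w.2 m, show e w w.2 = 1 from congrArg Subtype.val hw, one_smul]
    · obtain ⟨w, hw, hwm⟩ := hbackward q q.2
      exact ⟨⟨w, hw⟩, Subtype.ext (hext fun m ↦ (hem w hw m).trans (hwm m).symm)⟩
  exact ⟨MulEquiv.ofBijective E hE, fun w m ↦ hem w w.2 m⟩

end WeylGroup

end FoldedRootDatum

end

/-! ### The main theorem -/

open FoldedRootDatum in
theorem mainTheorem5 {ι M N A : Type*} [Fintype ι] [AddCommGroup M] [AddCommGroup N]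
    [Module.Finite ℤ M] [Module.Finite ℤ N] [Group A]
    (P : RootDatum ι M N) (hP : P.IsReduced) (b : P.Base)
    (ρ : A →* P.Aut) (hρ : ∀ a, ∀ i ∈ b.support, ρ a • i ∈ b.support) :
    (∀ i j, proj ρ (P.root i) = proj ρ (P.root j) → ∃ a, ρ a • i = j) ∧
    RA ρ = RA₁ b ρ ∪ RA₂ b ρ ∧
    (∃ Q : RootDatum (RA₁ b ρ) (CoinvLattice ρ) (InvLattice ρ),
      IsFolded b ρ (RA₁ b ρ) Q ∧ Q.IsReduced ∧
      (∃ b₁ : Q.Base, Q.root '' b₁.support = ΔA b ρ) ∧ HasWeylGroup ρ Q) ∧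
    (∃ Q : RootDatum (RA₂ b ρ) (CoinvLattice ρ) (InvLattice ρ),
      IsFolded b ρ (RA₂ b ρ) Q ∧ Q.IsReduced ∧
      (∃ b₂ : Q.Base, Q.root '' b₂.support = ΔA₂ b ρ) ∧ HasWeylGroup ρ Q) ∧
    (∃ Q : RootDatum (RA ρ) (CoinvLattice ρ) (InvLattice ρ),
      IsFolded b ρ (RA ρ) Q ∧ IsBasis Q (ΔA b ρ) ∧ HasWeylGroup ρ Q) := by
  have := hP
  refine ⟨fun i j h ↦ mem_orbit_of_proj_eq hρ h, RA_eq_union hρ, ?_, ?_, ?_⟩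
  · rw [RA₁_eq hρ]
    have hp : ∀ w ∈ fixedWeyl ρ, ∀ i, ¬ Div ρ i → ¬ Div ρ (w • i) :=
      fun w hw i h ↦ by rwa [div_smul_iff hw]
    refine ⟨foldedDatum hρ _ hp, isFolded_foldedDatum hρ _ hp, div_datum_isReduced hρ hp,
      exists_base_not_div hρ hp, hasWeylGroup_foldedDatum hρ hp fun i hi ↦ ?_⟩
    -- A divisible image 2γ is missing from this datum, but its reflection is that of γ.
    by_cases hd : Div ρ i
    · obtain ⟨k, l, hl, h⟩ := hd
      have hk : Mult ρ k := ⟨l, hl, pairing_of_root_eq_add hρ hl h⟩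
      refine ⟨k, fun hkd ↦ not_mult_and_div hρ k ⟨hk, hkd⟩, fun m ↦ ?_⟩
      rw [orbitCoroot_of_mult hk, orbC_of_root_eq_add hρ hl h, proj_of_root_eq_add hl h, map_smul,
        smul_smul, smul_eq_mul, mul_comm]
    · exact ⟨i, hd, fun m ↦ by rw [orbitCoroot_of_not_mult hi]⟩
  · rw [RA₂_eq hρ]
    have hp : ∀ w ∈ fixedWeyl ρ, ∀ i, ¬ Mult ρ i → ¬ Mult ρ (w • i) :=
      fun w hw i h ↦ by rwa [mult_smul_iff hw]
    exact ⟨foldedDatum hρ _ hp, isFolded_foldedDatum hρ _ hp, mult_datum_isReduced hρ hp,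
      exists_base_not_mult hρ hp, hasWeylGroup_foldedDatum hρ hp fun i hi ↦
        ⟨i, hi, fun m ↦ by rw [orbitCoroot_of_not_mult hi]⟩⟩
  -- The predicate is membership in `Set.univ` so that the index set of the datum is `RA ρ` by
  -- definition.
  · have hp : ∀ w ∈ fixedWeyl ρ, ∀ i : ι, i ∈ Set.univ → w • i ∈ Set.univ :=
      fun _ _ _ _ ↦ Set.mem_univ _
    exact ⟨foldedDatum hρ _ hp, isFolded_foldedDatum hρ _ hp, isBasis_foldedDatum hρ hp,
      hasWeylGroup_foldedDatum hρ hp fun i hi ↦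
        ⟨i, Set.mem_univ _, fun m ↦ by rw [orbitCoroot_of_not_mult hi]⟩⟩
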